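/- Let $\mathbf k$ be a field in which $2\neq 0$. **Networks.** A *perfect planar network* is a finite directed graph $\Gamma$ embedded in an oriented disk such that the vertices on the boundary are univalent, the internal vertices are trivalent, and no internal vertex is a source or a sink. An internal vertex is *white* if it has a unique incoming edge and *black* if it has a unique outgoing edge. Assume that $\Gamma$ is acyclic (it has no oriented cycles) and has $m$ sources and $n$ sinks, all on the boundary, and that the sources and the sinks are *separated*: going clockwise along the boundary one meets first the sinks, numbered $1,\dots,n$ in this order, and then the sources, in the order $m,m-1,\dots,1$. **Double bracket.** Let $\mathcal C$ be the $\mathbf k$-linear category of paths in $\Gamma$: its objects are the vertices, $\mathrm{Hom}(a,b)$ is the vector space spanned by the paths from $a$ to $b$, and $fg$ denotes the concatenation of $f$ followed by $g$. For a tensor $f\otimes g$ put $(f\otimes g)^\tau=g\otimes f$, and multiply tensors by $(f\otimes g)(h\otimes l)=fh\otimes gl$. A double bracket on $\mathcal C$ is a family of linear maps $\{\!\!\{-,-\}\!\!\}:\mathrm{Hom}(a,b)\otimes\mathrm{Hom}(c,d)\to\mathrm{Hom}(c,b)\otimes\mathrm{Hom}(a,d)$ with $\{\!\!\{f,g\}\!\!\}=-\{\!\!\{g,f\}\!\!\}^\tau$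 and $$\{\!\!\{fg,h\}\!\!\}=(\mathbf 1_{s(h)}\otimes f)\{\!\!\{g,h\}\!\!\}+\{\!\!\{f,h\}\!\!\}(g\otimes\mathbf 1_{t(h)}),\qquad \{\!\!\{f,gh\}\!\!\}=(g\otimes\mathbf 1_{s(f)})\{\!\!\{f,h\}\!\!\}+\{\!\!\{f,g\}\!\!\}(\mathbf 1_{t(f)}\otimes h),$$ where $s$ and $t$ denote the source and the target. It is determined by its values on pairs of edges. Let $w_{12},w_{13},w_{23},b_{12},b_{13},b_{23}\in\mathbf k$ satisfy $$w_{12}+w_{13}-w_{23}=\tfrac12,\qquad b_{12}+b_{13}-b_{23}=-\tfrac12 ,$$ and let the bracket of two edges be the sum of the following contributions (completed by skew-symmetry) of the internal vertices $V$. If $V$ is white and $x_1,x_2,x_3$ are the edges at $V$ in counterclockwise order, $x_3$ being the incoming one, then $V$ contributes $$\{\!\!\{x_1,x_2\}\!\!\}=w_{12}\,x_1\otimes x_2,\quad \{\!\!\{x_1,x_3\}\!\!\}=w_{13}\,x_3x_1\otimes\mathbf 1_V,\quad \{\!\!\{x_2,x_3\}\!\!\}=w_{23}\,x_3x_2\otimes\mathbf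 1_V ;$$ if $V$ is black and $y_1,y_2,y_3$ are the edges at $V$ in counterclockwise order, $y_3$ being the outgoing one, then $V$ contributes $$\{\!\!\{y_1,y_2\}\!\!\}=b_{12}\,y_2\otimes y_1,\quad \{\!\!\{y_1,y_3\}\!\!\}=b_{13}\,\mathbf 1_V\otimes y_1y_3,\quad \{\!\!\{y_2,y_3\}\!\!\}=b_{23}\,\mathbf 1_V\otimes y_2y_3 .$$ (This is the double bracket of the twisted ribbon graph of $\Gamma$, for instance with $w_{12}=\frac12$, $b_{12}=-\frac12$ and all other coefficients $0$, or with $(w_{12},w_{13},w_{23})=(\frac12,-\frac12,-\frac12)$ and $(b_{12},b_{13},b_{23})=(-\frac12,\frac12,\frac12)$.) **Matrices.** The *boundary measurement matrix* $B=B_\Gamma$ is the $m\times n$ matrix over $\mathcal C$ whose entry $b_{ij}$ is the sum of all paths from source $i$ to sink $j$. Let $B_L$ and $B_R$ be the matrices with entries $b_{ij}\otimes 1$ and $1\otimes b_{ij}$, let $\boxtimes$ be the Kronecker product of matrices, let $\tau$ act on matrices over $\mathcal C\otimes\mathcal C$ entry by entry, put $\{\!\!\{B,B\}\!\!\}=\sum_{i,j,k,l}\{\!\!\{b_{ij},b_{kl}\}\!\!\}\,E_{ij}\boxtimes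 E_{kl}$, and for $N\ge 0$ let $$r_N=\frac12\sum_{1\le i<j\le N}\left(E_{ji}\boxtimes E_{ij}-E_{ij}\boxtimes E_{ji}\right).$$ **Theorem.** For every such network, $$\{\!\!\{B,B\}\!\!\}=r_m\,(B_L\boxtimes B_R)-\Big((B_L\boxtimes B_R)\,r_n\Big)^{\tau}.$$ In particular, if $B$ is square ($m=n$), then $\{\!\!\{B,B\}\!\!\}=[r_n,\,B_L\boxtimes B_R]_\tau$, where $[X,Y]_\tau=XY-(YX)^\tau$. -/

import Mathlib

open scoped TensorProduct Kronecker

noncomputable section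

/-! ## The path algebra of a quiver

The `k`-linear category generated by the arrows of a quiver, regarded as an algebra with many
objects: its elements are formal linear combinations of paths, and the product is concatenation,
written in the order of travel (and `0` for paths that do not compose). -/

/-- All paths of a quiver, with their source and target. -/
abbrev PathIndex (Q : Type*) [Quiver Q] := Σ a b : Q, Quiver.Path a b

/-- Formal `k`-linear combinations of paths. -/
def PathAlgebra (k : Type*) (Q : Type*) [CommRing k] [Quiver Q] := PathIndex Q →₀ k

namespace PathAlgebra

section Basic

variable (k : Type*) {Q : Type*} [CommRing k] [Quiver Q]

instance (priority := low) : AddCommGroup (PathAlgebra k Q) := inferInstanceAs (AddCommGroup (PathIndex Q →₀ k))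

instance (priority := low) : Module k (PathAlgebra k Q) := inferInstanceAs (Module k (PathIndex Q →₀ k))

/-- A path, as an element of the path algebra. -/
def ofPath {a b : Q} (p : Quiver.Path a b) : PathAlgebra k Q :=
  Finsupp.single (⟨a, b, p⟩ : PathIndex Q) (1 : k)

/-- The identity morphism of the object `a`, that is, the constant path at `a`. -/
def idem (a : Q) : PathAlgebra k Q := ofPath k (Quiver.Path.nil : Quiver.Path a a)

/-- The linear map with prescribed values on paths. -/
def lift {M : Type*} [AddCommGroup M] [Module k M] (φ : PathIndex Q → M) :
    PathAlgebra k Q →ₗ[k] M :=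
  Finsupp.linearCombination k φ

theorem lift_ofPath {M : Type*} [AddCommGroup M] [Module k M] (φ : PathIndex Q → M)
    {a b : Q} (p : Quiver.Path a b) : lift k φ (ofPath k p) = φ ⟨a, b, p⟩ :=
  (Finsupp.linearCombination_single k (1 : k) (⟨a, b, p⟩ : PathIndex Q)).trans (one_smul k _)

theorem induction {P : PathAlgebra k Q → Prop} (x : PathAlgebra k Q) (zero : P 0)
    (add : ∀ x y, P x → P y → P (x + y)) (smul : ∀ (r : k) x, P x → P (r • x))
    (path : ∀ {a b : Q} (p : Quiver.Path a b), P (ofPath k p)) : P x := by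
  refine Finsupp.induction_linear (motive := P) x zero add fun i r => ?_
  have h : (Finsupp.single i r : PathIndex Q →₀ k) = r • Finsupp.single i 1 := by
    rw [Finsupp.smul_single, smul_eq_mul, mul_one]
  have h' := smul r _ (path i.2.2)
  exact h ▸ h'

open Classical in
/-- Concatenation of two paths: `0` if they are not composable. -/
def concat (x y : PathIndex Q) : PathAlgebra k Q :=
  if h : y.1 = x.2.1 then ofPath k (x.2.2.comp (y.2.2.cast h rfl)) else 0

/-- The product of the path algebra, as a bilinear map. -/
def mulMap : PathAlgebra k Q →ₗ[k] PathAlgebra k Q →ₗ[k] PathAlgebra k Q :=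
  lift k fun x => lift k fun y => concat k x y

theorem mulMap_comp {a b c : Q} (p : Quiver.Path a b) (q : Quiver.Path b c) :
    mulMap k (ofPath k p) (ofPath k q) = ofPath k (p.comp q) := by
  simp [mulMap, lift_ofPath, concat]

theorem mulMap_of_ne {a b c d : Q} (p : Quiver.Path a b) (q : Quiver.Path c d) (h : c ≠ b) :
    mulMap k (ofPath k p) (ofPath k q) = 0 := by
  simp [mulMap, lift_ofPath, concat, h]

theorem mulMap_assoc (x y z : PathAlgebra k Q) :
    mulMap k (mulMap k x y) z = mulMap k x (mulMap k y z) := by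
  induction x using PathAlgebra.induction with
  | zero => simp
  | add x x' hx hx' => simp [hx, hx']
  | smul r x hx => simp [hx]
  | @path a b p =>
  induction y using PathAlgebra.induction with
  | zero => simp
  | add x x' hx hx' => simp [hx, hx']
  | smul r x hx => simp [hx]
  | @path c d q =>
  induction z using PathAlgebra.induction with
  | zero => simp
  | add x x' hx hx' => simp [hx, hx']
  | smul r x hx => simp [hx]
  | @path e f r =>
  by_cases h : c = b
  · subst h
    by_cases h' : e = d
    · subst h'
      simp [mulMap_comp, Quiver.Path.comp_assoc]
    · simp [mulMap_comp, mulMap_of_ne k _ _ h']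
  · by_cases h' : e = d
    · subst h'
      simp [mulMap_comp, mulMap_of_ne k _ _ h]
    · simp [mulMap_of_ne k _ _ h, mulMap_of_ne k _ _ h']

instance : Mul (PathAlgebra k Q) := ⟨fun x y => mulMap k x y⟩

instance [Fintype Q] : One (PathAlgebra k Q) := ⟨∑ a : Q, idem k a⟩

theorem mul_def (x y : PathAlgebra k Q) : x * y = mulMap k x y := rfl

theorem one_def [Fintype Q] : (1 : PathAlgebra k Q) = ∑ a : Q, idem k a := rfl

theorem ofPath_mul_ofPath {a b c : Q} (p : Quiver.Path a b) (q : Quiver.Path b c) :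
    ofPath k p * ofPath k q = ofPath k (p.comp q) := mulMap_comp k p q

theorem ofPath_mul_ofPath_of_ne {a b c d : Q} (p : Quiver.Path a b) (q : Quiver.Path c d)
    (h : c ≠ b) : ofPath k p * ofPath k q = 0 := mulMap_of_ne k p q h

theorem idem_mul_ofPath {a b : Q} (p : Quiver.Path a b) : idem k a * ofPath k p = ofPath k p := by
  rw [idem, ofPath_mul_ofPath, Quiver.Path.nil_comp]

theorem ofPath_mul_idem {a b : Q} (p : Quiver.Path a b) : ofPath k p * idem k b = ofPath k p := by
  rw [idem, ofPath_mul_ofPath, Quiver.Path.comp_nil]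

theorem idem_mul_idem (a : Q) : idem k a * idem k a = idem k a := idem_mul_ofPath k _

theorem ofPath_cons {a b c : Q} (p : Quiver.Path a b) (e : b ⟶ c) :
    ofPath k (p.cons e) = ofPath k p * ofPath k e.toPath := by
  rw [ofPath_mul_ofPath]; rfl

instance [Fintype Q] : Ring (PathAlgebra k Q) :=
  { (inferInstance : AddCommGroup (PathAlgebra k Q)) with
    mul := (· * ·)
    one := 1
    left_distrib := fun x y z => by simp [mul_def]
    right_distrib := fun x y z => by simp [mul_def]
    zero_mul := fun x => by simp [mul_def]
    mul_zero := fun x => by simp [mul_def]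
    mul_assoc := fun x y z => mulMap_assoc k x y z
    one_mul := fun x => by
      rw [mul_def]
      induction x using PathAlgebra.induction with
      | zero => simp
      | add x x' hx hx' => rw [map_add, hx, hx']
      | smul r x hx => rw [map_smul, hx]
      | @path a b p =>
        rw [one_def, map_sum, LinearMap.sum_apply, Finset.sum_eq_single a]
        · exact idem_mul_ofPath k p
        · intro c _ hc
          exact mulMap_of_ne k _ _ hc.symm
        · simp
    mul_one := fun x => by
      rw [mul_def]
      induction x using PathAlgebra.induction with
      | zero => simp
      | add x x' hx hx' => rw [map_add, LinearMap.add_apply, hx, hx']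
      | smul r x hx => rw [map_smul, LinearMap.smul_apply, hx]
      | @path a b p =>
        rw [one_def, map_sum, Finset.sum_eq_single b]
        · exact ofPath_mul_idem k p
        · intro c _ hc
          exact mulMap_of_ne k _ _ hc
        · simp }

instance [Fintype Q] : Algebra k (PathAlgebra k Q) :=
  Algebra.ofModule (fun r x y => by simp [mul_def]) (fun r x y => by simp [mul_def])

end Basic

end PathAlgebra

/-! ## Double brackets -/

section DoubleBracket

variable (k : Type*) (Q : Type*) [CommRing k] [Quiver Q] [Fintype Q]

/-- The transposition `τ` of the two tensor factors. -/
def tensorSwap : PathAlgebra k Q ⊗[k] PathAlgebra k Q →ₗ[k] PathAlgebra k Q ⊗[k] PathAlgebra k Q :=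
  (TensorProduct.comm k (PathAlgebra k Q) (PathAlgebra k Q)).toLinearMap

/-- A double bracket on the linear category of paths of a quiver: a skew-symmetric bilinear
operation `Hom(a,b) ⊗ Hom(c,d) → Hom(c,b) ⊗ Hom(a,d)` subject to both double Leibniz identities. -/
structure DoubleBracket where
  /-- The underlying bilinear map. -/
  bracket : PathAlgebra k Q →ₗ[k] PathAlgebra k Q →ₗ[k] PathAlgebra k Q ⊗[k] PathAlgebra k Q
  source_target : ∀ {a b c d : Q} (f : Quiver.Path a b) (g : Quiver.Path c d),
    (PathAlgebra.idem k c ⊗ₜ[k] PathAlgebra.idem k a) *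
        bracket (PathAlgebra.ofPath k f) (PathAlgebra.ofPath k g) *
        (PathAlgebra.idem k b ⊗ₜ[k] PathAlgebra.idem k d) =
      bracket (PathAlgebra.ofPath k f) (PathAlgebra.ofPath k g)
  skew : ∀ f g, bracket f g = -tensorSwap k Q (bracket g f)
  leibniz_left : ∀ {a b c s t : Q} (f : Quiver.Path a b) (g : Quiver.Path b c)
      (h : Quiver.Path s t),
    bracket (PathAlgebra.ofPath k f * PathAlgebra.ofPath k g) (PathAlgebra.ofPath k h) =
      (PathAlgebra.idem k s ⊗ₜ[k] PathAlgebra.ofPath k f) *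
          bracket (PathAlgebra.ofPath k g) (PathAlgebra.ofPath k h) +
        bracket (PathAlgebra.ofPath k f) (PathAlgebra.ofPath k h) *
          (PathAlgebra.ofPath k g ⊗ₜ[k] PathAlgebra.idem k t)
  leibniz_right : ∀ {s t a b c : Q} (f : Quiver.Path s t) (g : Quiver.Path a b)
      (h : Quiver.Path b c),
    bracket (PathAlgebra.ofPath k f) (PathAlgebra.ofPath k g * PathAlgebra.ofPath k h) =
      (PathAlgebra.ofPath k g ⊗ₜ[k] PathAlgebra.idem k s) *
          bracket (PathAlgebra.ofPath k f) (PathAlgebra.ofPath k h) +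
        bracket (PathAlgebra.ofPath k f) (PathAlgebra.ofPath k g) *
          (PathAlgebra.idem k t ⊗ₜ[k] PathAlgebra.ofPath k h)

/-- Skew-symmetric values of a double bracket on pairs of arrows, with the sources and targets
that a double bracket requires. -/
structure ArrowBracket where
  /-- The value on a pair of arrows. -/
  val : ∀ {a b c d : Q}, (a ⟶ b) → (c ⟶ d) → PathAlgebra k Q ⊗[k] PathAlgebra k Q
  source : ∀ {a b c d : Q} (e : a ⟶ b) (f : c ⟶ d),
    (PathAlgebra.idem k c ⊗ₜ[k] PathAlgebra.idem k a) * val e f = val e f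
  target : ∀ {a b c d : Q} (e : a ⟶ b) (f : c ⟶ d),
    val e f * (PathAlgebra.idem k b ⊗ₜ[k] PathAlgebra.idem k d) = val e f
  skew : ∀ {a b c d : Q} (e : a ⟶ b) (f : c ⟶ d), val e f = -tensorSwap k Q (val f e)

namespace ArrowBracket

variable {k Q}

/-- The double bracket of an arrow and a path, computed by the second Leibniz identity from the
values on pairs of arrows. -/
def extendRight (L : ArrowBracket k Q) {a b c : Q} (e : a ⟶ b) :
    ∀ {d : Q}, Quiver.Path c d → PathAlgebra k Q ⊗[k] PathAlgebra k Q
  | _, Quiver.Path.nil => 0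
  | _, Quiver.Path.cons q f =>
      (PathAlgebra.ofPath k q ⊗ₜ[k] PathAlgebra.idem k a) * L.val e f +
        L.extendRight e q * (PathAlgebra.idem k b ⊗ₜ[k] PathAlgebra.ofPath k f.toPath)

/-- The double bracket of two paths, computed by the first Leibniz identity from the brackets of
an arrow and a path. -/
def extend (L : ArrowBracket k Q) {a c d : Q} :
    ∀ {b : Q}, Quiver.Path a b → Quiver.Path c d → PathAlgebra k Q ⊗[k] PathAlgebra k Q
  | _, Quiver.Path.nil, _ => 0
  | _, Quiver.Path.cons p e, q =>
      (PathAlgebra.idem k c ⊗ₜ[k] PathAlgebra.ofPath k p) * L.extendRight e q +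
        L.extend p q * (PathAlgebra.ofPath k e.toPath ⊗ₜ[k] PathAlgebra.idem k d)

theorem swap_mul (x y : PathAlgebra k Q ⊗[k] PathAlgebra k Q) :
    tensorSwap k Q (x * y) = tensorSwap k Q x * tensorSwap k Q y :=
  map_mul (Algebra.TensorProduct.comm k (PathAlgebra k Q) (PathAlgebra k Q)) x y

theorem swap_tmul (x y : PathAlgebra k Q) : tensorSwap k Q (x ⊗ₜ[k] y) = y ⊗ₜ[k] x := rfl

theorem extendRight_source (L : ArrowBracket k Q) {a b c d : Q} (e : a ⟶ b)
    (q : Quiver.Path c d) :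
    (PathAlgebra.idem k c ⊗ₜ[k] PathAlgebra.idem k a) * L.extendRight e q =
      L.extendRight e q := by
  induction q with
  | nil => simp [extendRight]
  | cons q f ih =>
    rw [extendRight, mul_add, ← mul_assoc, ← mul_assoc, ih,
      Algebra.TensorProduct.tmul_mul_tmul, PathAlgebra.idem_mul_ofPath, PathAlgebra.idem_mul_idem]

theorem extendRight_target (L : ArrowBracket k Q) {a b c d : Q} (e : a ⟶ b)
    (q : Quiver.Path c d) :
    L.extendRight e q * (PathAlgebra.idem k b ⊗ₜ[k] PathAlgebra.idem k d) =
      L.extendRight e q := by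
  cases q with
  | nil => simp [extendRight]
  | cons q f =>
    rw [extendRight, add_mul, mul_assoc, mul_assoc, L.target,
      Algebra.TensorProduct.tmul_mul_tmul, PathAlgebra.ofPath_mul_idem, PathAlgebra.idem_mul_idem]

theorem extend_source (L : ArrowBracket k Q) {a b c d : Q} (p : Quiver.Path a b)
    (q : Quiver.Path c d) :
    (PathAlgebra.idem k c ⊗ₜ[k] PathAlgebra.idem k a) * L.extend p q = L.extend p q := by
  induction p with
  | nil => simp [extend]
  | cons p e ih =>
    rw [extend, mul_add, ← mul_assoc, ← mul_assoc, ih,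
      Algebra.TensorProduct.tmul_mul_tmul, PathAlgebra.idem_mul_ofPath, PathAlgebra.idem_mul_idem]

theorem extend_target (L : ArrowBracket k Q) {a b c d : Q} (p : Quiver.Path a b)
    (q : Quiver.Path c d) :
    L.extend p q * (PathAlgebra.idem k b ⊗ₜ[k] PathAlgebra.idem k d) = L.extend p q := by
  cases p with
  | nil => simp [extend]
  | cons p e =>
    rw [extend, add_mul, mul_assoc, mul_assoc, extendRight_target,
      Algebra.TensorProduct.tmul_mul_tmul, PathAlgebra.ofPath_mul_idem, PathAlgebra.idem_mul_idem]

theorem extend_toPath_cons (L : ArrowBracket k Q) {a b c d s : Q} (f : c ⟶ d)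
    (q : Quiver.Path s a) (e : a ⟶ b) :
    L.extend (q.cons e) f.toPath =
      (PathAlgebra.idem k c ⊗ₜ[k] PathAlgebra.ofPath k q) * L.val e f +
        L.extend q f.toPath * (PathAlgebra.ofPath k e.toPath ⊗ₜ[k] PathAlgebra.idem k d) := by
  rw [extend]
  congr 2
  change (PathAlgebra.idem k c ⊗ₜ[k] PathAlgebra.idem k a) * L.val e f + 0 * _ = _
  rw [L.source, zero_mul, add_zero]

theorem extendRight_eq_neg_swap (L : ArrowBracket k Q) {a b c d : Q} (e : a ⟶ b)
    (q : Quiver.Path c d) :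
    L.extendRight e q = -tensorSwap k Q (L.extend q e.toPath) := by
  induction q with
  | nil => simp [extendRight, extend]
  | cons q f ih =>
    rw [extend_toPath_cons, extendRight, ih, L.skew e f, map_add, swap_mul, swap_mul, swap_tmul,
      swap_tmul]
    simp only [mul_neg, neg_mul, neg_add]

theorem extendRight_comp (L : ArrowBracket k Q) {a b c d s : Q} (e : a ⟶ b)
    (q : Quiver.Path c d) (r : Quiver.Path d s) :
    L.extendRight e (q.comp r) =
      (PathAlgebra.ofPath k q ⊗ₜ[k] PathAlgebra.idem k a) * L.extendRight e r +
        L.extendRight e q * (PathAlgebra.idem k b ⊗ₜ[k] PathAlgebra.ofPath k r) := by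
  induction r with
  | nil =>
    have h := L.extendRight_target e q
    simp only [extendRight, Quiver.Path.comp_nil, mul_zero, zero_add]
    exact h.symm
  | cons r f ih =>
    rw [Quiver.Path.comp_cons, extendRight, ih, extendRight, add_mul, mul_add, PathAlgebra.ofPath_cons,
      mul_assoc (L.extendRight e q), Algebra.TensorProduct.tmul_mul_tmul, PathAlgebra.idem_mul_idem,
      ← PathAlgebra.ofPath_mul_ofPath, ← mul_assoc, ← mul_assoc,
      Algebra.TensorProduct.tmul_mul_tmul, PathAlgebra.idem_mul_idem, add_assoc]

theorem extend_comp_left (L : ArrowBracket k Q) {a b c s t : Q} (f : Quiver.Path a b)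
    (g : Quiver.Path b c) (h : Quiver.Path s t) :
    L.extend (f.comp g) h =
      (PathAlgebra.idem k s ⊗ₜ[k] PathAlgebra.ofPath k f) * L.extend g h +
        L.extend f h * (PathAlgebra.ofPath k g ⊗ₜ[k] PathAlgebra.idem k t) := by
  induction g with
  | nil =>
    have h' := L.extend_target f h
    simp only [extend, Quiver.Path.comp_nil, mul_zero, zero_add]
    exact h'.symm
  | cons g e ih =>
    rw [Quiver.Path.comp_cons, extend, ih, extend, add_mul, mul_add, PathAlgebra.ofPath_cons,
      mul_assoc (L.extend f h), Algebra.TensorProduct.tmul_mul_tmul, PathAlgebra.idem_mul_idem,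
      ← PathAlgebra.ofPath_mul_ofPath, ← mul_assoc, ← mul_assoc,
      Algebra.TensorProduct.tmul_mul_tmul, PathAlgebra.idem_mul_idem, add_assoc]

theorem extend_comp_right (L : ArrowBracket k Q) {a b c s t : Q} (f : Quiver.Path s t)
    (g : Quiver.Path a b) (h : Quiver.Path b c) :
    L.extend f (g.comp h) =
      (PathAlgebra.ofPath k g ⊗ₜ[k] PathAlgebra.idem k s) * L.extend f h +
        L.extend f g * (PathAlgebra.idem k t ⊗ₜ[k] PathAlgebra.ofPath k h) := by
  induction f with
  | nil => simp [extend]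
  | @cons u t f e ih =>
    rw [extend, extend, extend, extendRight_comp, ih]
    simp only [mul_add, add_mul, ← mul_assoc, Algebra.TensorProduct.tmul_mul_tmul,
      PathAlgebra.idem_mul_ofPath, PathAlgebra.ofPath_mul_idem]
    simp only [mul_assoc, Algebra.TensorProduct.tmul_mul_tmul, PathAlgebra.idem_mul_ofPath,
      PathAlgebra.ofPath_mul_idem]
    abel

theorem extend_skew (L : ArrowBracket k Q) {a b c d : Q} (p : Quiver.Path a b)
    (q : Quiver.Path c d) : L.extend p q = -tensorSwap k Q (L.extend q p) := by
  induction p with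
  | nil =>
    have h : ∀ {t : Q} (r : Quiver.Path c t),
        L.extend r (Quiver.Path.nil : Quiver.Path a a) = 0 := by
      intro t r
      induction r with
      | nil => rfl
      | cons r e ih => simp [extend, extendRight, ih]
    rw [h]; simp [extend]
  | cons p e ih =>
    have h := L.extend_comp_right q p e.toPath
    change L.extend q (p.cons e) = _ at h
    rw [h, extend, ih, extendRight_eq_neg_swap, map_add, swap_mul, swap_mul, swap_tmul, swap_tmul]
    simp only [mul_neg, neg_mul, neg_add]

/-- The double bracket with the given values on arrows: values on paths are computed by the
double Leibniz identities, and extended bilinearly. -/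
def toDoubleBracket (L : ArrowBracket k Q) : DoubleBracket k Q where
  bracket := PathAlgebra.lift k fun x => PathAlgebra.lift k fun y => L.extend x.2.2 y.2.2
  source_target f g := by
    simp only [PathAlgebra.lift_ofPath, extend_source, extend_target]
  skew f g := by
    induction f using PathAlgebra.induction with
    | zero => simp
    | add x x' hx hx' => simp only [map_add, LinearMap.add_apply, hx, hx', neg_add]
    | smul r x hx => simp only [map_smul, LinearMap.smul_apply, hx, smul_neg]
    | path p =>
    induction g using PathAlgebra.induction with
    | zero => simp
    | add x x' hx hx' => simp only [map_add, LinearMap.add_apply, hx, hx', neg_add]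
    | smul r x hx => simp only [map_smul, LinearMap.smul_apply, hx, smul_neg]
    | path q =>
      simp only [PathAlgebra.lift_ofPath]
      exact L.extend_skew p q
  leibniz_left f g h := by
    simp only [PathAlgebra.ofPath_mul_ofPath, PathAlgebra.lift_ofPath, extend_comp_left]
  leibniz_right f g h := by
    simp only [PathAlgebra.ofPath_mul_ofPath, PathAlgebra.lift_ofPath, extend_comp_right]

theorem toDoubleBracket_arrow (L : ArrowBracket k Q) {a b c d : Q} (e : a ⟶ b) (f : c ⟶ d) :
    L.toDoubleBracket.bracket (PathAlgebra.ofPath k e.toPath) (PathAlgebra.ofPath k f.toPath) =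
      L.val e f := by
  simp only [toDoubleBracket, PathAlgebra.lift_ofPath]
  rw [Quiver.Hom.toPath, extend_toPath_cons]
  change (PathAlgebra.idem k c ⊗ₜ[k] PathAlgebra.idem k a) * L.val e f + 0 * _ = _
  rw [L.source, zero_mul, add_zero]

end ArrowBracket

end DoubleBracket

/-! ## Perfect planar networks -/

/-- The vertices of a network in a disk: `m` boundary sources, `n` boundary sinks, and the
internal vertices. -/
inductive NetworkVertex (m n : ℕ) (I : Type*)
  | source (i : Fin m)
  | sink (j : Fin n)
  | inner (v : I)

/-- The number of orbits of a permutation group. -/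
def orbitCount {D : Type*} (G : Subgroup (Equiv.Perm D)) : ℕ :=
  Nat.card (MulAction.orbitRel.Quotient G D)

/-- A perfect network embedded in an oriented disk, with `m` sources and `n` sinks separated from
each other on the boundary; `I` is the set of internal vertices and `E` the set of edges.

The edge `e` has two half-edges: `Sum.inl e` at its source and `Sum.inr e` at its target.
The embedding is recorded, up to orientation-preserving homeomorphism, by its rotation system.
Collapsing the boundary circle of the disk to one point turns the disk into a sphere, and the
network into a graph on that sphere whose vertices are the internal vertices and one further
vertex `∞`, the image of all boundary vertices. The permutation `rotation` sends each half-edge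
to the next one in counterclockwise order around its vertex on the sphere. Around `∞` this is the
clockwise order of the boundary vertices along the boundary of the disk, that is: sinks
`1, …, n`, then sources `m, …, 1`. (Sources and sinks are both numbered from top to bottom,
the sources lying on the left side of the disk and the sinks on the right side.) -/
structure PerfectPlanarNetwork (m n : ℕ) (I E : Type*) [Fintype I] [Fintype E] where
  /-- The source of an edge. -/
  src : E → NetworkVertex m n I
  /-- The target of an edge. -/
  tgt : E → NetworkVertex m n I
  /-- The only edge at a boundary source. -/
  sourceEdge : Fin m → E
  /-- The only edge at a boundary sink. -/
  sinkEdge : Fin n → E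
  src_eq_source : ∀ e i, src e = NetworkVertex.source i ↔ e = sourceEdge i
  tgt_ne_source : ∀ e i, tgt e ≠ NetworkVertex.source i
  tgt_eq_sink : ∀ e j, tgt e = NetworkVertex.sink j ↔ e = sinkEdge j
  src_ne_sink : ∀ e j, src e ≠ NetworkVertex.sink j
  /-- Internal vertices are trivalent. -/
  trivalent : ∀ v : I, Nat.card {h : E ⊕ E // Sum.elim src tgt h = NetworkVertex.inner v} = 3
  /-- Internal vertices are not sources. -/
  exists_incoming : ∀ v : I, ∃ e, tgt e = NetworkVertex.inner v
  /-- Internal vertices are not sinks. -/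
  exists_outgoing : ∀ v : I, ∃ e, src e = NetworkVertex.inner v
  /-- The next half-edge in counterclockwise order, around each vertex of the sphere. -/
  rotation : Equiv.Perm (E ⊕ E)
  rotation_inner : ∀ (v : I) (h : E ⊕ E), Sum.elim src tgt h = NetworkVertex.inner v →
    Sum.elim src tgt (rotation h) = NetworkVertex.inner v
  rotation_sameCycle : ∀ (v : I) (h h' : E ⊕ E), Sum.elim src tgt h = NetworkVertex.inner v →
    Sum.elim src tgt h' = NetworkVertex.inner v → rotation.SameCycle h h'
  rotation_boundary : ∀ i : Fin (n + m),
    rotation (Fin.append (fun j => Sum.inr (sinkEdge j))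
        (fun i => Sum.inl (sourceEdge (Fin.rev i))) i) =
      Fin.append (fun j => Sum.inr (sinkEdge j))
        (fun i => Sum.inl (sourceEdge (Fin.rev i))) (finRotate (n + m) i)
  /-- Planarity, that is, Euler's formula `V + F = E + 2 C` on the sphere. The vertices, edges,
  faces and connected components are the orbits on half-edges of the rotation, of the exchange of
  the two halves of each edge, of their composite, and of the group which they generate. -/
  planar :
    orbitCount (Subgroup.zpowers rotation) +
        orbitCount (Subgroup.zpowers (rotation * Equiv.sumComm E E)) =
      orbitCount (Subgroup.zpowers (Equiv.sumComm E E : Equiv.Perm (E ⊕ E))) +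
        2 * orbitCount (Subgroup.closure {rotation, (Equiv.sumComm E E : Equiv.Perm (E ⊕ E))})

/-- Six scalars: the coefficients of the local brackets at the white and at the black vertices. -/
structure LocalWeights (k : Type*) where
  (w₁₂ w₁₃ w₂₃ b₁₂ b₁₃ b₂₃ : k)

/-- The local weights of the surface of the twisted ribbon graph, in which the ribbons of edges
between vertices of different colours are half-twisted: the orientation is reversed at the black
vertices. -/
def LocalWeights.twistedRibbon (k : Type*) [Field k] : LocalWeights k where
  w₁₂ := 1 / 2
  w₁₃ := -(1 / 2)
  w₂₃ := -(1 / 2)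
  b₁₂ := -(1 / 2)
  b₁₃ := 1 / 2
  b₂₃ := 1 / 2

theorem LocalWeights.twistedRibbon_white (k : Type*) [Field k] :
    (twistedRibbon k).w₁₂ + (twistedRibbon k).w₁₃ - (twistedRibbon k).w₂₃ = 1 / 2 := by
  simp [twistedRibbon]

theorem LocalWeights.twistedRibbon_black (k : Type*) [Field k] :
    (twistedRibbon k).b₁₂ + (twistedRibbon k).b₁₃ - (twistedRibbon k).b₂₃ = -(1 / 2) := by
  simp [twistedRibbon]

namespace PerfectPlanarNetwork

section Network

variable {m n : ℕ} {I E : Type*} [Fintype I] [Fintype E]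

/-- The vertices of a network, as the objects of a quiver. -/
def Vertex (_N : PerfectPlanarNetwork m n I E) := NetworkVertex m n I

variable (N : PerfectPlanarNetwork m n I E)

/-- The arrows from `a` to `b` are the edges from `a` to `b`. -/
instance : Quiver N.Vertex := ⟨fun a b => {e : E // N.src e = a ∧ N.tgt e = b}⟩

instance : Fintype N.Vertex :=
  Fintype.ofEquiv (Fin m ⊕ Fin n ⊕ I)
    { toFun := Sum.elim NetworkVertex.source (Sum.elim NetworkVertex.sink NetworkVertex.inner)
      invFun := fun x => match x with
        | NetworkVertex.source i => Sum.inl i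
        | NetworkVertex.sink j => Sum.inr (Sum.inl j)
        | NetworkVertex.inner v => Sum.inr (Sum.inr v)
      left_inv := by rintro (i | j | v) <;> rfl
      right_inv := by rintro (i | j | v) <;> rfl }

/-- The `i`-th boundary source. -/
def source (i : Fin m) : N.Vertex := NetworkVertex.source i

/-- The `j`-th boundary sink. -/
def sink (j : Fin n) : N.Vertex := NetworkVertex.sink j

/-- The internal vertex `v`. -/
def inner (v : I) : N.Vertex := NetworkVertex.inner v

/-- There are no oriented cycles. -/
def Acyclic : Prop := ∀ (a : N.Vertex) (p : Quiver.Path a a), p.length = 0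

/-- The edge `e`, as an arrow. -/
def arrow (e : E) : (show N.Vertex from N.src e) ⟶ (show N.Vertex from N.tgt e) := ⟨e, rfl, rfl⟩

section Bracket

variable (k : Type*) [Field k]

/-- The edge `e`, as an element of the path algebra. -/
def edge (e : E) : PathAlgebra k N.Vertex := PathAlgebra.ofPath k (N.arrow e).toPath

/-- The identity morphism of the internal vertex `v`. -/
def innerIdem (v : I) : PathAlgebra k N.Vertex := PathAlgebra.idem k (N.inner v)

/-- The internal vertex `v` is white, and `x₁, x₂, x₃` are the edges at `v` in counterclockwise
order, `x₃` being the only incoming one. -/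
def IsWhite (v : I) (x₁ x₂ x₃ : E) : Prop :=
  N.src x₁ = NetworkVertex.inner v ∧ N.src x₂ = NetworkVertex.inner v ∧
    N.tgt x₃ = NetworkVertex.inner v ∧
    N.rotation (Sum.inl x₁) = Sum.inl x₂ ∧ N.rotation (Sum.inl x₂) = Sum.inr x₃ ∧
    N.rotation (Sum.inr x₃) = Sum.inl x₁

/-- The internal vertex `v` is black, and `y₁, y₂, y₃` are the edges at `v` in counterclockwise
order, `y₃` being the only outgoing one. -/
def IsBlack (v : I) (y₁ y₂ y₃ : E) : Prop :=
  N.tgt y₁ = NetworkVertex.inner v ∧ N.tgt y₂ = NetworkVertex.inner v ∧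
    N.src y₃ = NetworkVertex.inner v ∧
    N.rotation (Sum.inr y₁) = Sum.inr y₂ ∧ N.rotation (Sum.inr y₂) = Sum.inl y₃ ∧
    N.rotation (Sum.inl y₃) = Sum.inr y₁

open Classical in
/-- The contribution of the internal vertex `v` to the bracket of the edges `e` and `f`, when these
are the edges with labels `1,2`, or `1,3`, or `2,3` in this order: at a white vertex
`⟦x₁,x₂⟧ = w₁₂ x₁ ⊗ x₂`, `⟦x₁,x₃⟧ = w₁₃ x₃x₁ ⊗ 𝟏`, `⟦x₂,x₃⟧ = w₂₃ x₃x₂ ⊗ 𝟏`, and at a black vertex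
`⟦y₁,y₂⟧ = b₁₂ y₂ ⊗ y₁`, `⟦y₁,y₃⟧ = b₁₃ 𝟏 ⊗ y₁y₃`, `⟦y₂,y₃⟧ = b₂₃ 𝟏 ⊗ y₂y₃`. -/
def vertexTerm (c : LocalWeights k) (v : I) (e f : E) :
    PathAlgebra k N.Vertex ⊗[k] PathAlgebra k N.Vertex :=
  (if ∃ x, N.IsWhite v e f x then c.w₁₂ • (N.edge k e ⊗ₜ[k] N.edge k f) else 0) +
  (if ∃ x, N.IsWhite v e x f then
    c.w₁₃ • ((N.edge k f * N.edge k e) ⊗ₜ[k] N.innerIdem k v) else 0) +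
  (if ∃ x, N.IsWhite v x e f then
    c.w₂₃ • ((N.edge k f * N.edge k e) ⊗ₜ[k] N.innerIdem k v) else 0) +
  (if ∃ y, N.IsBlack v e f y then c.b₁₂ • (N.edge k f ⊗ₜ[k] N.edge k e) else 0) +
  (if ∃ y, N.IsBlack v e y f then
    c.b₁₃ • (N.innerIdem k v ⊗ₜ[k] (N.edge k e * N.edge k f)) else 0) +
  (if ∃ y, N.IsBlack v y e f then
    c.b₂₃ • (N.innerIdem k v ⊗ₜ[k] (N.edge k e * N.edge k f)) else 0)

/-- The double bracket of two edges: the sum of the contributions of all internal vertices,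
completed by skew-symmetry. -/
def edgeBracket (c : LocalWeights k) (e f : E) :
    PathAlgebra k N.Vertex ⊗[k] PathAlgebra k N.Vertex :=
  ∑ v : I, (N.vertexTerm k c v e f - tensorSwap k N.Vertex (N.vertexTerm k c v f e))

theorem idem_mul_edge (e : E) {a : N.Vertex} (h : N.src e = a) :
    PathAlgebra.idem k a * N.edge k e = N.edge k e := by
  subst h; exact PathAlgebra.idem_mul_ofPath k _

theorem edge_mul_idem (e : E) {a : N.Vertex} (h : N.tgt e = a) :
    N.edge k e * PathAlgebra.idem k a = N.edge k e := by
  subst h; exact PathAlgebra.ofPath_mul_idem k _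

theorem idem_mul_innerIdem (v : I) {a : N.Vertex} (h : NetworkVertex.inner v = a) :
    PathAlgebra.idem k a * N.innerIdem k v = N.innerIdem k v := by
  subst h; exact PathAlgebra.idem_mul_idem k _

theorem innerIdem_mul_idem (v : I) {a : N.Vertex} (h : NetworkVertex.inner v = a) :
    N.innerIdem k v * PathAlgebra.idem k a = N.innerIdem k v := by
  subst h; exact PathAlgebra.idem_mul_idem k _

theorem vertexTerm_source (c : LocalWeights k) (v : I) (e f : E) {a b : N.Vertex}
    (ha : N.src e = a) (hb : N.src f = b) :
    (PathAlgebra.idem k b ⊗ₜ[k] PathAlgebra.idem k a) * N.vertexTerm k c v e f =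
      N.vertexTerm k c v e f := by
  unfold vertexTerm
  simp only [mul_add, mul_ite, mul_zero, mul_smul_comm, Algebra.TensorProduct.tmul_mul_tmul,
    ← mul_assoc, N.idem_mul_edge k e ha, N.idem_mul_edge k f hb]
  congr 1; congr 1; congr 1; congr 1; congr 1
  all_goals
    split_ifs with h
    swap
    · rfl
  · obtain ⟨x, h1, h2, h3, -⟩ := h
    rw [N.idem_mul_edge k e (h1.trans (h2.symm.trans hb)),
      N.idem_mul_edge k f (h2.trans (h1.symm.trans ha))]
  · obtain ⟨x, h1, h2, h3, -⟩ := h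
    rw [N.idem_mul_innerIdem k v (h1.symm.trans ha)]
  · obtain ⟨x, h1, h2, h3, -⟩ := h
    rw [N.idem_mul_innerIdem k v (h2.symm.trans ha)]
  · obtain ⟨x, h1, h2, h3, -⟩ := h
    rw [N.idem_mul_innerIdem k v (h3.symm.trans hb)]
  · obtain ⟨x, h1, h2, h3, -⟩ := h
    rw [N.idem_mul_innerIdem k v (h3.symm.trans hb)]

theorem vertexTerm_target (c : LocalWeights k) (v : I) (e f : E) {b d : N.Vertex}
    (hb : N.tgt e = b) (hd : N.tgt f = d) :
    N.vertexTerm k c v e f * (PathAlgebra.idem k b ⊗ₜ[k] PathAlgebra.idem k d) =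
      N.vertexTerm k c v e f := by
  unfold vertexTerm
  simp only [add_mul, ite_mul, zero_mul, smul_mul_assoc, Algebra.TensorProduct.tmul_mul_tmul,
    mul_assoc, N.edge_mul_idem k e hb, N.edge_mul_idem k f hd]
  congr 1; congr 1; congr 1; congr 1; congr 1
  all_goals
    split_ifs with h
    swap
    · rfl
  · obtain ⟨x, h1, h2, h3, -⟩ := h
    rw [N.innerIdem_mul_idem k v (h3.symm.trans hd)]
  · obtain ⟨x, h1, h2, h3, -⟩ := h
    rw [N.innerIdem_mul_idem k v (h3.symm.trans hd)]
  · obtain ⟨x, h1, h2, h3, -⟩ := h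
    rw [N.edge_mul_idem k e (h1.trans (h2.symm.trans hd)),
      N.edge_mul_idem k f (h2.trans (h1.symm.trans hb))]
  · obtain ⟨x, h1, h2, h3, -⟩ := h
    rw [N.innerIdem_mul_idem k v (h1.symm.trans hb)]
  · obtain ⟨x, h1, h2, h3, -⟩ := h
    rw [N.innerIdem_mul_idem k v (h2.symm.trans hb)]

theorem swap_swap (x : PathAlgebra k N.Vertex ⊗[k] PathAlgebra k N.Vertex) :
    tensorSwap k N.Vertex (tensorSwap k N.Vertex x) = x :=
  (TensorProduct.comm k (PathAlgebra k N.Vertex) (PathAlgebra k N.Vertex)).symm_apply_apply x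

/-- The local double brackets of all pairs of edges. -/
def arrowBracket (c : LocalWeights k) : ArrowBracket k N.Vertex where
  val e f := N.edgeBracket k c e.1 f.1
  source := by
    rintro a b a' b' ⟨e, ha, hb⟩ ⟨f, ha', hb'⟩
    have h := fun v => congrArg (tensorSwap k N.Vertex) (N.vertexTerm_source k c v f e ha' ha)
    simp only [ArrowBracket.swap_mul, ArrowBracket.swap_tmul] at h
    simp only [edgeBracket, Finset.mul_sum, mul_sub, N.vertexTerm_source k c _ e f ha ha', h]
  target := by
    rintro a b a' b' ⟨e, ha, hb⟩ ⟨f, ha', hb'⟩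
    have h := fun v => congrArg (tensorSwap k N.Vertex) (N.vertexTerm_target k c v f e hb' hb)
    simp only [ArrowBracket.swap_mul, ArrowBracket.swap_tmul] at h
    simp only [edgeBracket, Finset.sum_mul, sub_mul, N.vertexTerm_target k c _ e f hb hb', h]
  skew e f := by
    simp only [edgeBracket, map_sum, map_sub, swap_swap, ← Finset.sum_neg_distrib, neg_sub]

/-- The double bracket on the category of paths of the network with local weights `c`. -/
def doubleBracket (c : LocalWeights k) : DoubleBracket k N.Vertex :=
  (N.arrowBracket k c).toDoubleBracket

/-- The boundary measurement matrix: the `(i,j)` entry is the sum of all paths from the `i`-th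
source to the `j`-th sink. For an acyclic network there are finitely many of them
(`finite_path_of_acyclic`). -/
def boundaryMeasurement : Matrix (Fin m) (Fin n) (PathAlgebra k N.Vertex) :=
  Matrix.of fun i j => ∑ᶠ p : Quiver.Path (N.source i) (N.sink j), PathAlgebra.ofPath k p

end Bracket

theorem finite_path_of_length (a : N.Vertex) (l : ℕ) (b : N.Vertex) :
    {p : Quiver.Path a b | p.length ≤ l}.Finite := by
  induction l generalizing b with
  | zero =>
    refine Set.Subsingleton.finite ?_
    intro p hp q hq
    cases p with
    | cons p e => simp at hp
    | nil => exact (Quiver.Path.eq_nil_of_length_zero q (Nat.le_zero.mp hq)).symm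
  | succ l ih =>
    have hfin : ∀ c : N.Vertex, Finite (c ⟶ b) := fun c =>
      inferInstanceAs (Finite {e : E // N.src e = c ∧ N.tgt e = b})
    have h : (⋃ c : N.Vertex, Set.image2 (fun (p : Quiver.Path a c) (e : c ⟶ b) => p.cons e)
        {p | p.length ≤ l} Set.univ).Finite :=
      Set.finite_iUnion fun c => Set.Finite.image2 _ (ih c) (Set.toFinite _)
    refine (h.union (Set.Subsingleton.finite (s := {p : Quiver.Path a b | p.length = 0}) ?_)).subset
      ?_
    · intro p hp q hq
      cases p with
      | cons p e => simp at hp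
      | nil => exact (Quiver.Path.eq_nil_of_length_zero q hq).symm
    · intro p hp
      cases p with
      | nil => exact Or.inr rfl
      | cons p e =>
        refine Or.inl (Set.mem_iUnion.mpr ⟨_, p, ?_, e, Set.mem_univ _, rfl⟩)
        simpa using hp

theorem finite_path_of_acyclic (hN : N.Acyclic) (a b : N.Vertex) :
    Finite (Quiver.Path a b) := by
  classical
  let R : N.Vertex → Finset N.Vertex := fun b => Finset.univ.filter fun x =>
    Nonempty (Quiver.Path x b)
  have key : ∀ {b : N.Vertex} (p : Quiver.Path a b), p.length + (R a).card ≤ (R b).card := by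
    intro b p
    induction p with
    | nil => simp
    | @cons c d p e ih =>
      have hlt : R c ⊂ R d := by
        refine Finset.ssubset_iff_of_subset ?_ |>.mpr ⟨d, ?_, ?_⟩
        · intro x hx
          obtain ⟨q⟩ := (Finset.mem_filter.mp hx).2
          exact Finset.mem_filter.mpr ⟨Finset.mem_univ _, ⟨q.cons e⟩⟩
        · exact Finset.mem_filter.mpr ⟨Finset.mem_univ _, ⟨Quiver.Path.nil⟩⟩
        · intro hx
          obtain ⟨q⟩ := (Finset.mem_filter.mp hx).2
          exact absurd (hN d (q.cons e)) (by simp)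
      have := Finset.card_lt_card hlt
      simp only [Quiver.Path.length_cons]
      omega
  have h := N.finite_path_of_length a (R b).card b
  refine Set.finite_univ_iff.mp (h.subset fun p _ => ?_)
  have h' := key p
  exact le_trans (Nat.le_add_right _ _) h'

end Network

end PerfectPlanarNetwork

/-! ## Matrices over the path algebra -/

section Matrices

variable {k Q : Type*} [Field k] [Quiver Q] [Fintype Q]

/-- The matrix `⟦X,Y⟧ = ∑ ⟦x_ij, y_kl⟧ E_ij ⊠ E_kl`. -/
def DoubleBracket.matrixBracket {ι κ ι' κ' : Type*} (D : DoubleBracket k Q)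
    (X : Matrix ι κ (PathAlgebra k Q)) (Y : Matrix ι' κ' (PathAlgebra k Q)) :
    Matrix (ι × ι') (κ × κ') (PathAlgebra k Q ⊗[k] PathAlgebra k Q) :=
  Matrix.of fun p q => D.bracket (X p.1 q.1) (Y p.2 q.2)

/-- The matrix `X_L`, with entries `x_ij ⊗ 1`. -/
def matrixL {ι κ : Type*} (X : Matrix ι κ (PathAlgebra k Q)) :
    Matrix ι κ (PathAlgebra k Q ⊗[k] PathAlgebra k Q) :=
  X.map fun x => x ⊗ₜ[k] (1 : PathAlgebra k Q)

/-- The matrix `X_R`, with entries `1 ⊗ x_ij`. -/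
def matrixR {ι κ : Type*} (X : Matrix ι κ (PathAlgebra k Q)) :
    Matrix ι κ (PathAlgebra k Q ⊗[k] PathAlgebra k Q) :=
  X.map fun x => (1 : PathAlgebra k Q) ⊗ₜ[k] x

/-- The transposition `τ` of the tensor factors, applied to each entry of a matrix. -/
def matrixSwap {ι κ : Type*} (X : Matrix ι κ (PathAlgebra k Q ⊗[k] PathAlgebra k Q)) :
    Matrix ι κ (PathAlgebra k Q ⊗[k] PathAlgebra k Q) :=
  X.map (tensorSwap k Q)

/-- The twisted commutator `[X,Y]_τ = XY - (YX)^τ`. -/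
def twistedCommutator {ι : Type*} [Fintype ι]
    (X Y : Matrix ι ι (PathAlgebra k Q ⊗[k] PathAlgebra k Q)) :
    Matrix ι ι (PathAlgebra k Q ⊗[k] PathAlgebra k Q) :=
  X * Y - matrixSwap (Y * X)

variable (k Q) in
/-- The matrix `r_n = (1/2) ∑_{i<j} (E_ji ⊠ E_ij - E_ij ⊠ E_ji)`, with scalar entries regarded as
elements of the tensor square of the path algebra. -/
def rMatrix (n : ℕ) :
    Matrix (Fin n × Fin n) (Fin n × Fin n) (PathAlgebra k Q ⊗[k] PathAlgebra k Q) :=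
  Matrix.map
    ((1 / 2 : k) • ∑ i : Fin n, ∑ j : Fin n, if i < j then
      Matrix.single j i (1 : k) ⊗ₖ Matrix.single i j (1 : k) -
        Matrix.single i j (1 : k) ⊗ₖ Matrix.single j i (1 : k) else 0)
    (algebraMap k (PathAlgebra k Q ⊗[k] PathAlgebra k Q))

end Matrices

end

/-! Planarity enters through heights. In an acyclic network every edge lies on a path from a source
to a sink, and the sum of one such path for each edge is a strictly positive flow. Once the boundary
is collapsed to a point of the sphere, this flow is conserved at every vertex. On a sphere such a
flow is the jump of a function on the faces (`exists_faceFunction`), so the faces have heights for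
which each edge has the higher face on its left (`exists_height`). Each edge thus owns the interval
between the heights of its right and left faces.

The network is then swept. Let `S` be a set of internal vertices closed under predecessors, let only
`S` contribute to the bracket, and let `P_i(e)` be the sum of the paths from source `i` with last
edge `e`. For edges `e`, `f` across the cut behind `S` there are two invariants: distinct edges have
intervals that do not overlap, and `⟦P_i(e), P_i'(f)⟧ = ½ (sgn(i - i') + sgn(h(f) - h(e))) P_i'(e) ⊗
P_i(f)`, where `h` is the height on the right (`cutFormula`).

For empty `S` the bracket is zero, and in the only nonzero tensor the two signs cancel because the
heights of the source edges decrease with their numbers (`cut_empty`). A white vertex splits the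
interval of its incoming edge in two, and its weights supply the missing `½` that compares the two
branches (`cut_insert_white`). A black vertex merges two adjacent intervals, and its weights `∓½`
cancel the signs that compared the incoming edges (`cut_insert_black`).

When `S` is everything, `P_i` of the sink edges gives the entries of `B`. The heights of the sinks
decrease too, so `⟦b_ij, b_kl⟧ = ½ (sgn(i - k) + sgn(j - l)) b_kj ⊗ b_il`
(`bracket_boundaryMeasurement`). The two signs are the contributions of `r_m` and `r_n`. -/

/-! ## Functions on the half-edges of a map on the sphere -/

section Invariants

variable {D : Type*}

/-- The rational functions that are constant on the orbits of a permutation group. -/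
def invariantFunctions (G : Subgroup (Equiv.Perm D)) : Submodule ℚ (D → ℚ) :=
  LinearMap.range (LinearMap.funLeft ℚ ℚ
    (Quotient.mk _ : D → MulAction.orbitRel.Quotient G D))

/-- Turns Euler's formula, stated with numbers of orbits, into an identity between dimensions of
function spaces. -/
theorem finrank_invariantFunctions [Fintype D] (G : Subgroup (Equiv.Perm D)) :
    Module.finrank ℚ (invariantFunctions G) = orbitCount G := by
  classical
  have : Finite (MulAction.orbitRel.Quotient G D) := Quotient.finite _
  have := Fintype.ofFinite (MulAction.orbitRel.Quotient G D)
  rw [invariantFunctions, LinearMap.finrank_range_of_inj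
    (LinearMap.funLeft_injective_of_surjective ℚ ℚ _ Quotient.mk_surjective),
    Module.finrank_fintype_fun_eq_card, orbitCount, Nat.card_eq_fintype_card]

theorem mem_invariantFunctions {G : Subgroup (Equiv.Perm D)} {f : D → ℚ} :
    f ∈ invariantFunctions G ↔ ∀ g ∈ G, ∀ x, f (g x) = f x := by
  constructor
  · rintro ⟨F, rfl⟩ g hg x
    exact congrArg F (Quotient.sound (MulAction.orbitRel_apply.mpr ⟨⟨g, hg⟩, rfl⟩))
  · intro h
    refine ⟨Quotient.lift f ?_, rfl⟩
    intro a b hab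
    obtain ⟨⟨g, hg⟩, rfl⟩ := MulAction.orbitRel_apply.mp hab
    exact h g hg b

theorem mem_invariantFunctions_closure {s : Set (Equiv.Perm D)} {f : D → ℚ} :
    f ∈ invariantFunctions (Subgroup.closure s) ↔ ∀ g ∈ s, ∀ x, f (g x) = f x := by
  rw [mem_invariantFunctions]
  refine ⟨fun h g hg => h g (Subgroup.subset_closure hg), fun h g hg => ?_⟩
  induction hg using Subgroup.closure_induction with
  | mem g hg => exact h g hg
  | one => exact fun x => rfl
  | mul g g' _ _ hg hg' => exact fun x => (hg _).trans (hg' x)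
  | inv g _ hg => exact fun x => by rw [← hg (g⁻¹ x)]; simp

theorem mem_invariantFunctions_zpowers {σ : Equiv.Perm D} {f : D → ℚ} :
    f ∈ invariantFunctions (Subgroup.zpowers σ) ↔ ∀ x, f (σ x) = f x := by
  rw [Subgroup.zpowers_eq_closure, mem_invariantFunctions_closure]
  simp

end Invariants

/-! ### Flows and face functions on the sphere. -/

section Height

variable {E : Type*}

/-- The difference of the values at the two halves of an edge. -/
def edgeDifference (E : Type*) : (E ⊕ E → ℚ) →ₗ[ℚ] (E ⊕ E → ℚ) :=
  LinearMap.funLeft ℚ ℚ Sum.swap - LinearMap.id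

theorem edgeDifference_apply (f : E ⊕ E → ℚ) (d : E ⊕ E) :
    edgeDifference E f d = f d.swap - f d := rfl

theorem sum_comp_swap [Fintype E] (f : E ⊕ E → ℚ) : ∑ d, f (Sum.swap d) = ∑ d, f d :=
  Equiv.sum_comp (Equiv.sumComm E E) f

/-- Summation by parts: exchanging the halves of each edge shows that both terms of the difference
contribute equally. -/
theorem sum_mul_edgeDifference [Fintype E] {w : E ⊕ E → ℚ} (hw : ∀ d, w d.swap = -w d)
    (g : E ⊕ E → ℚ) :
    ∑ d, w d * edgeDifference E g d = -2 * ∑ d, w d * g d := by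
  have h : ∑ d, w d * g d.swap = -∑ d, w d * g d := by
    rw [← sum_comp_swap fun d => w d * g d.swap, ← Finset.sum_neg_distrib]
    exact Finset.sum_congr rfl fun d _ => by rw [hw, Sum.swap_swap, neg_mul]
  simp only [edgeDifference_apply, mul_sub, Finset.sum_sub_distrib, h]
  ring

/-- Rank-nullity, the kernel of the difference on the functions invariant under `G` being the
functions invariant under `H`. For vertices and faces it yields the dimensions `V - C` and `F - C`.
-/
theorem finrank_map_edgeDifference_add [Fintype E] (G : Subgroup (Equiv.Perm (E ⊕ E)))
    (H : Subgroup (Equiv.Perm (E ⊕ E)))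
    (h : ∀ f, f ∈ invariantFunctions H ↔
      f ∈ invariantFunctions G ∧ ∀ d : E ⊕ E, f d.swap = f d) :
    Module.finrank ℚ ((invariantFunctions G).map (edgeDifference E)) + orbitCount H =
      orbitCount G := by
  rw [← finrank_invariantFunctions, ← finrank_invariantFunctions,
    ← LinearMap.finrank_range_add_finrank_ker
      ((edgeDifference E).domRestrict (invariantFunctions G)), LinearMap.range_domRestrict]
  congr 1
  rw [← Submodule.finrank_map_subtype_eq]
  refine congrArg (fun S : Submodule ℚ (E ⊕ E → ℚ) => Module.finrank ℚ S) ?_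
  ext f
  rw [h]
  simp only [Submodule.mem_map, LinearMap.mem_ker, LinearMap.domRestrict_apply]
  constructor
  · rintro ⟨hf, hf'⟩
    exact ⟨⟨f, hf⟩, funext fun d => sub_eq_zero.mpr (hf' d), rfl⟩
  · rintro ⟨⟨f, hf⟩, hf', rfl⟩
    exact ⟨hf, fun d => sub_eq_zero.mp (congrFun hf' d)⟩

/-- The skew-symmetric functions on the half-edges. -/
def skewFunctions (E : Type*) : Submodule ℚ (E ⊕ E → ℚ) :=
  LinearMap.ker (LinearMap.funLeft ℚ ℚ (Sum.swap : E ⊕ E → E ⊕ E) + LinearMap.id)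

theorem mem_skewFunctions {f : E ⊕ E → ℚ} : f ∈ skewFunctions E ↔ ∀ d, f d.swap = -f d := by
  rw [skewFunctions, LinearMap.mem_ker, funext_iff]
  exact forall_congr' fun d => add_eq_zero_iff_eq_neg

/-- Multiplication by `1` on the source halves and `-1` on the target halves makes skew functions
invariant under the exchange of halves. -/
theorem finrank_skewFunctions_le [Fintype E] :
    Module.finrank ℚ (skewFunctions E) ≤
      orbitCount (Subgroup.zpowers (Equiv.sumComm E E : Equiv.Perm (E ⊕ E))) := by
  rw [← finrank_invariantFunctions]
  let s : E ⊕ E → ℚ := Sum.elim (fun _ => 1) fun _ => -1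
  let m : (E ⊕ E → ℚ) →ₗ[ℚ] (E ⊕ E → ℚ) := LinearMap.mulLeft ℚ s
  have hs : ∀ d, s d * s d = 1 := by rintro (e | e) <;> simp [s]
  have hs' : ∀ d, s d.swap = -s d := by rintro (e | e) <;> simp [s]
  have hm : Function.Injective m := by
    intro f g h
    funext d
    have := congrFun h d
    simp only [m, LinearMap.mulLeft_apply, Pi.mul_apply] at this
    rw [← one_mul (f d), ← one_mul (g d), ← hs, mul_assoc, this, mul_assoc]
  rw [(Submodule.equivMapOfInjective m hm (skewFunctions E)).finrank_eq]
  refine Submodule.finrank_mono ?_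
  rintro _ ⟨f, hf, rfl⟩
  refine mem_invariantFunctions_zpowers.mpr fun d => ?_
  have := mem_skewFunctions.mp hf d
  simp only [m, LinearMap.mulLeft_apply, Pi.mul_apply, Equiv.sumComm_apply, this, hs']
  ring

/-- On a sphere every flow on the edges is the difference of a function on the faces. -/
theorem exists_faceFunction [Fintype E] (σ : Equiv.Perm (E ⊕ E))
    (hσ : orbitCount (Subgroup.zpowers σ) +
        orbitCount (Subgroup.zpowers (σ * Equiv.sumComm E E)) =
      orbitCount (Subgroup.zpowers (Equiv.sumComm E E : Equiv.Perm (E ⊕ E))) +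
        2 * orbitCount (Subgroup.closure {σ, (Equiv.sumComm E E : Equiv.Perm (E ⊕ E))}))
    (w : E ⊕ E → ℚ) (hw : ∀ d, w d.swap = -w d)
    (hw' : ∀ g : E ⊕ E → ℚ, (∀ d, g (σ d) = g d) → ∑ d, w d * g d = 0) :
    ∃ h : E ⊕ E → ℚ, (∀ d, h (σ d) = h d.swap) ∧ ∀ d, h d.swap - h d = w d := by
  -- `X` and `Y` consist of the differences of vertex functions and of face functions. They are
  -- orthogonal, of dimensions `V - C` and `F - C`, so by Euler's formula they fill the space of
  -- skew functions. A flow is orthogonal to `X`, hence lies in `Y`.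
  set Γ := Subgroup.closure {σ, (Equiv.sumComm E E : Equiv.Perm (E ⊕ E))} with hΓ
  set X := (invariantFunctions (Subgroup.zpowers σ)).map (edgeDifference E) with hX
  set Y := (invariantFunctions (Subgroup.zpowers (σ * Equiv.sumComm E E))).map
    (edgeDifference E) with hY
  have hΓ' : ∀ f, f ∈ invariantFunctions Γ ↔
      (∀ d, f (σ d) = f d) ∧ ∀ d : E ⊕ E, f d.swap = f d := by
    intro f
    rw [hΓ, mem_invariantFunctions_closure]
    simp
  have h1 := finrank_map_edgeDifference_add (Subgroup.zpowers σ) Γ (fun f => by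
    rw [hΓ', mem_invariantFunctions_zpowers])
  have h2 := finrank_map_edgeDifference_add (Subgroup.zpowers (σ * Equiv.sumComm E E)) Γ
    (fun f => by
      rw [hΓ', mem_invariantFunctions_zpowers]
      refine and_congr_left fun h => ⟨fun h' d => ?_, fun h' d => ?_⟩
      · exact (h' _).trans (h d)
      · have := h' d.swap
        rw [Equiv.Perm.mul_apply, Equiv.sumComm_apply, Sum.swap_swap] at this
        rw [this, h])
  rw [← hX] at h1
  rw [← hY] at h2
  have hface : ∀ {h : E ⊕ E → ℚ},
      h ∈ invariantFunctions (Subgroup.zpowers (σ * Equiv.sumComm E E)) →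
        ∀ d, h (σ d) = h d.swap := by
    intro h hh d
    have := mem_invariantFunctions_zpowers.mp hh d.swap
    rwa [Equiv.Perm.mul_apply, Equiv.sumComm_apply, Sum.swap_swap] at this
  have hskew : ∀ f : E ⊕ E → ℚ, ∀ d, edgeDifference E f d.swap = -edgeDifference E f d := by
    intro f d
    rw [edgeDifference_apply, edgeDifference_apply, Sum.swap_swap, neg_sub]
  -- Writing `h` of the other half as `h ∘ σ` and `g` as `g ∘ σ` makes the sum a difference of two
  -- sums that agree after reindexing by `σ`.
  have horth : ∀ h ∈ invariantFunctions (Subgroup.zpowers (σ * Equiv.sumComm E E)),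
      ∀ g ∈ invariantFunctions (Subgroup.zpowers σ),
        ∑ d, edgeDifference E h d * g d = 0 := by
    intro h hh g hg
    have e : ∀ d, edgeDifference E h d * g d = h (σ d) * g (σ d) - h d * g d := by
      intro d
      rw [edgeDifference_apply, hface hh, mem_invariantFunctions_zpowers.mp hg, sub_mul]
    simp only [e, Finset.sum_sub_distrib]
    rw [Equiv.sum_comp σ fun d => h d * g d, sub_self]
  have hzero : ∀ u : E ⊕ E → ℚ, ∑ d, u d * u d = 0 → u = 0 := by
    intro u hu
    funext d
    have := (Finset.sum_eq_zero_iff_of_nonneg fun d _ => mul_self_nonneg (u d)).mp hu d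
      (Finset.mem_univ d)
    simpa using this
  have hdisj : X ⊓ Y = ⊥ := by
    rw [eq_bot_iff]
    rintro _ ⟨⟨g, hg, rfl⟩, h, hh, hgh⟩
    refine hzero _ ?_
    rw [sum_mul_edgeDifference (hskew g), ← hgh, horth h hh g hg, mul_zero]
  have hle : X ⊔ Y ≤ skewFunctions E := by
    refine sup_le ?_ ?_ <;>
    · rintro _ ⟨f, -, rfl⟩
      exact mem_skewFunctions.mpr (hskew f)
  have hdim := Submodule.finrank_sup_add_finrank_inf_eq X Y
  rw [hdisj, finrank_bot] at hdim
  have hE := finrank_skewFunctions_le (E := E)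
  have heq := Submodule.eq_of_le_of_finrank_le hle (by omega)
  have hmem := mem_skewFunctions.mpr hw
  rw [← heq] at hmem
  obtain ⟨_, ⟨g, hg, rfl⟩, _, ⟨h, hh, rfl⟩, hgh⟩ := Submodule.mem_sup.mp hmem
  -- The vertex component of `w` is orthogonal both to `w` and to the face component, hence to
  -- itself.
  have hg0 : edgeDifference E g = 0 := by
    refine hzero _ ?_
    have e : ∀ d, edgeDifference E g d * edgeDifference E g d =
        w d * edgeDifference E g d - edgeDifference E h d * edgeDifference E g d := by
      intro d
      rw [← hgh, Pi.add_apply]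
      ring
    simp only [e, Finset.sum_sub_distrib]
    rw [sum_mul_edgeDifference hw, sum_mul_edgeDifference (hskew h), horth h hh g hg,
      hw' g (mem_invariantFunctions_zpowers.mp hg), sub_self]
  refine ⟨h, hface hh, fun d => ?_⟩
  rw [← hgh, hg0, zero_add, edgeDifference_apply]

end Height

/-! ## Combinatorics of acyclic perfect planar networks -/

namespace PerfectPlanarNetwork

variable {m n : ℕ} {I E : Type*} [Fintype I] [Fintype E] (N : PerfectPlanarNetwork m n I E)

/-- The number of vertices from which a vertex can be reached grows strictly along an edge, since no
path leads back from its target to its source. -/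
theorem exists_rank (hN : N.Acyclic) :
    ∃ r : N.Vertex → ℕ, ∀ e, r (N.src e) < r (N.tgt e) := by
  classical
  refine ⟨fun a => (Finset.univ.filter fun x : N.Vertex => Nonempty (Quiver.Path x a)).card,
    fun e => Finset.card_lt_card ?_⟩
  refine Finset.ssubset_iff_of_subset ?_ |>.mpr ⟨N.tgt e, ?_, ?_⟩
  · intro x hx
    obtain ⟨q⟩ := (Finset.mem_filter.mp hx).2
    exact Finset.mem_filter.mpr ⟨Finset.mem_univ _, ⟨q.cons (N.arrow e)⟩⟩
  · exact Finset.mem_filter.mpr ⟨Finset.mem_univ _, ⟨Quiver.Path.nil⟩⟩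
  · intro hx
    obtain ⟨q⟩ := (Finset.mem_filter.mp hx).2
    exact Nat.succ_ne_zero _ (hN _ (q.cons (N.arrow e)))

theorem src_ne_tgt (hN : N.Acyclic) (e : E) : N.src e ≠ N.tgt e := by
  obtain ⟨r, hr⟩ := N.exists_rank hN
  exact fun h => (hr e).ne (congrArg r h)

theorem exists_path_from_source (hN : N.Acyclic) (b : N.Vertex) :
    ∃ i, Nonempty (Quiver.Path (N.source i) b) := by
  obtain ⟨r, hr⟩ := N.exists_rank hN
  induction h : r b using Nat.strong_induction_on generalizing b with
  | _ l ih =>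
    have key : ∀ e, N.tgt e = b → ∃ i, Nonempty (Quiver.Path (N.source i) b) := by
      rintro e rfl
      obtain ⟨i, ⟨p⟩⟩ := ih _ (h ▸ hr e) (N.src e) rfl
      exact ⟨i, ⟨p.cons (N.arrow e)⟩⟩
    match b with
    | NetworkVertex.source i => exact ⟨i, ⟨Quiver.Path.nil⟩⟩
    | NetworkVertex.sink j => exact key _ ((N.tgt_eq_sink _ j).mpr rfl)
    | NetworkVertex.inner v =>
      obtain ⟨e, he⟩ := N.exists_incoming v
      exact key e he

theorem exists_path_to_sink (hN : N.Acyclic) (a : N.Vertex) :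
    ∃ j, Nonempty (Quiver.Path a (N.sink j)) := by
  obtain ⟨r, hr⟩ := N.exists_rank hN
  -- The sum of all ranks serves as an upper bound for each rank, so this deficit drops along every
  -- edge.
  induction h : (∑ b, r b) - r a using Nat.strong_induction_on generalizing a with
  | _ l ih =>
    have key : ∀ e, N.src e = a → ∃ j, Nonempty (Quiver.Path a (N.sink j)) := by
      rintro e rfl
      have h1 := hr e
      have h2 : r (N.tgt e) ≤ ∑ b, r b :=
        Finset.single_le_sum (f := r) (fun _ _ => Nat.zero_le _) (Finset.mem_univ _)
      obtain ⟨j, ⟨p⟩⟩ := ih _ (by omega) (N.tgt e) rfl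
      exact ⟨j, ⟨(N.arrow e).toPath.comp p⟩⟩
    match a with
    | NetworkVertex.source i => exact key _ ((N.src_eq_source _ i).mpr rfl)
    | NetworkVertex.sink j => exact ⟨j, ⟨Quiver.Path.nil⟩⟩
    | NetworkVertex.inner v =>
      obtain ⟨e, he⟩ := N.exists_outgoing v
      exact key e he

open Classical in
/-- The number of times that a path runs through an edge. -/
noncomputable def edgeCount {a : N.Vertex} : ∀ {b : N.Vertex}, Quiver.Path a b → E → ℚ
  | _, Quiver.Path.nil, _ => 0
  | _, Quiver.Path.cons p f, e => edgeCount p e + if f.1 = e then 1 else 0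

theorem edgeCount_cons {a b c : N.Vertex} (p : Quiver.Path a b) (f : b ⟶ c) (e : E)
    [Decidable (f.1 = e)] :
    N.edgeCount (p.cons f) e = N.edgeCount p e + if f.1 = e then 1 else 0 := by
  rw [edgeCount]
  congr

theorem edgeCount_nonneg {a b : N.Vertex} (p : Quiver.Path a b) (e : E) :
    0 ≤ N.edgeCount p e := by
  induction p with
  | nil => exact le_rfl
  | cons p f ih =>
    rw [edgeCount]
    split_ifs <;> linarith

theorem edgeCount_comp {a b c : N.Vertex} (p : Quiver.Path a b) (q : Quiver.Path b c) (e : E) :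
    N.edgeCount (p.comp q) e = N.edgeCount p e + N.edgeCount q e := by
  induction q with
  | nil => simp [edgeCount]
  | cons q f ih => rw [Quiver.Path.comp_cons, edgeCount, ih, edgeCount, add_assoc]

/-- The sum telescopes along the path: a path is a flow whose divergence is concentrated at its two
ends. -/
theorem sum_edgeCount_mul {a b : N.Vertex} (p : Quiver.Path a b) (G : N.Vertex → ℚ) :
    ∑ e, N.edgeCount p e * (G (N.src e) - G (N.tgt e)) = G a - G b := by
  induction p with
  | nil => simp [edgeCount]
  | cons p f ih =>
    obtain ⟨f, hf, hf'⟩ := f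
    simp only [edgeCount, add_mul, Finset.sum_add_distrib, ih, ite_mul, zero_mul, one_mul]
    classical
    refine (congrArg (G a - G _ + ·)
      ((Finset.sum_ite_eq _ f _).trans (if_pos (Finset.mem_univ _)))).trans ?_
    rw [congrArg G hf, congrArg G hf']
    ring

/-! ### The boundary as the vertex at infinity. -/

theorem finRotate_eq_of_lt {M : ℕ} (i : Fin M) (h : (i : ℕ) + 1 < M) :
    finRotate M i = ⟨i + 1, h⟩ := by
  cases M with
  | zero => exact i.elim0
  | succ M => exact finRotate_of_lt (Nat.lt_of_succ_lt_succ h)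

/-- The half-edges at the boundary, in clockwise order. -/
def boundaryHalf (i : Fin (n + m)) : E ⊕ E :=
  Fin.append (fun j => Sum.inr (N.sinkEdge j)) (fun i => Sum.inl (N.sourceEdge (Fin.rev i))) i

theorem boundaryHalf_castAdd (j : Fin n) :
    N.boundaryHalf (Fin.castAdd m j) = Sum.inr (N.sinkEdge j) := Fin.append_left _ _ _

theorem boundaryHalf_natAdd (i : Fin m) :
    N.boundaryHalf (Fin.natAdd n i.rev) = Sum.inl (N.sourceEdge i) := by
  rw [boundaryHalf, Fin.append_right, Fin.rev_rev]

theorem rotation_boundaryHalf (i : Fin (n + m)) (h : (i : ℕ) + 1 < n + m) :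
    N.rotation (N.boundaryHalf i) = N.boundaryHalf ⟨i + 1, h⟩ := by
  rw [← finRotate_eq_of_lt i h]
  exact N.rotation_boundary i

theorem rotation_sinkEdge (j j' : Fin n) (h : (j : ℕ) + 1 = j') :
    N.rotation (Sum.inr (N.sinkEdge j)) = Sum.inr (N.sinkEdge j') := by
  rw [← boundaryHalf_castAdd, ← boundaryHalf_castAdd, N.rotation_boundaryHalf _ (by
    have := j'.2; simp; omega)]
  congr 1
  ext
  simpa using h

theorem rotation_sourceEdge (i i' : Fin m) (h : (i : ℕ) + 1 = i') :
    N.rotation (Sum.inl (N.sourceEdge i')) = Sum.inl (N.sourceEdge i) := by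
  rw [← boundaryHalf_natAdd, ← boundaryHalf_natAdd, N.rotation_boundaryHalf _ (by
    have := i'.2; simp; omega)]
  congr 1
  ext
  have := i'.2
  simp
  omega

/-- The half-edges at an internal vertex form a single cycle, so the function depends there only on
the vertex. The rotation around infinity links all boundary half-edges, which forces equal values at
sources and sinks. -/
theorem exists_vertexFunction (g : E ⊕ E → ℚ) (hg : ∀ d, g (N.rotation d) = g d) :
    ∃ G : N.Vertex → ℚ, (∀ d, g d = G (Sum.elim N.src N.tgt d)) ∧
      ∀ i j, G (N.source i) = G (N.sink j) := by
  choose o ho using N.exists_incoming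
  have hcycle : ∀ {d d'}, N.rotation.SameCycle d d' → g d = g d' := by
    rintro d _ ⟨l, rfl⟩
    have := mem_invariantFunctions.mp (mem_invariantFunctions_zpowers.mpr hg) _
      (Subgroup.zpow_mem_zpowers N.rotation l) d
    exact this.symm
  have hb : ∀ (l : ℕ) (hl : l < n + m),
      g (N.boundaryHalf ⟨l, hl⟩) = g (N.boundaryHalf ⟨0, by omega⟩) := by
    intro l hl
    induction l with
    | zero => rfl
    | succ l ih =>
      rw [← ih (by omega), ← hg (N.boundaryHalf ⟨l, _⟩), N.rotation_boundaryHalf ⟨l, by omega⟩ hl]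
  let G : N.Vertex → ℚ := fun x => match x with
    | NetworkVertex.source i => g (Sum.inl (N.sourceEdge i))
    | NetworkVertex.sink j => g (Sum.inr (N.sinkEdge j))
    | NetworkVertex.inner v => g (Sum.inr (o v))
  have hG : ∀ d x, Sum.elim N.src N.tgt d = x → g d = G x := by
    rintro d (i | j | v) hd
    · rcases d with e | e
      · exact congrArg (fun e => g (Sum.inl e)) ((N.src_eq_source e i).mp hd)
      · exact absurd hd (N.tgt_ne_source e i)
    · rcases d with e | e
      · exact absurd hd (N.src_ne_sink e j)
      · exact congrArg (fun e => g (Sum.inr e)) ((N.tgt_eq_sink e j).mp hd)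
    · exact hcycle (N.rotation_sameCycle v _ (Sum.inr (o v)) hd (ho v))
  refine ⟨G, fun d => hG d _ rfl, fun i j => ?_⟩
  · change g (Sum.inl (N.sourceEdge i)) = g (Sum.inr (N.sinkEdge j))
    rw [← boundaryHalf_castAdd, ← boundaryHalf_natAdd]
    exact (hb _ (Fin.natAdd n i.rev).2).trans (hb _ (Fin.castAdd m j).2).symm

/-- The faces of an acyclic network have heights for which every edge has the higher face on its
left; the height of a half-edge is that of the face on its right. -/
theorem exists_height (hN : N.Acyclic) :
    ∃ h : E ⊕ E → ℚ, (∀ d, h (N.rotation d) = h d.swap) ∧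
      ∀ e, h (Sum.inl e) < h (Sum.inr e) := by
  choose i p using N.exists_path_from_source hN
  choose j q using N.exists_path_to_sink hN
  -- One path from a source to a sink is chosen through each edge; adding up their edge counts makes
  -- the flow positive everywhere.
  let s : ∀ e : E, Quiver.Path (N.source (i (N.src e))) (N.sink (j (N.tgt e))) := fun e =>
    ((p (N.src e)).some.cons (N.arrow e)).comp (q (N.tgt e)).some
  let w : E → ℚ := fun e => ∑ e', N.edgeCount (s e') e
  have hw : ∀ e, 0 < w e := by
    intro e
    have h1 : N.edgeCount (s e) e ≤ w e := Finset.single_le_sum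
      (f := fun e' => N.edgeCount (s e') e) (fun e' _ => N.edgeCount_nonneg _ _)
      (Finset.mem_univ e)
    have h2 : N.edgeCount (s e) e =
        N.edgeCount (p (N.src e)).some e + 1 + N.edgeCount (q (N.tgt e)).some e := by
      classical
      rw [edgeCount_comp]
      exact congrArg (· + _) ((N.edgeCount_cons _ (N.arrow e) e).trans (by rw [if_pos]; rfl))
    have h3 := N.edgeCount_nonneg (p (N.src e)).some e
    have h4 := N.edgeCount_nonneg (q (N.tgt e)).some e
    linarith
  -- Both ends of each chosen path lie at infinity, where a vertex function has one value, so the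
  -- path pairs to zero with every vertex function.
  obtain ⟨h, hh, hh'⟩ := exists_faceFunction N.rotation N.planar (Sum.elim w fun e => -w e)
    (by rintro (e | e) <;> simp) (by
      intro g hg
      obtain ⟨G, hG, hG'⟩ := N.exists_vertexFunction g hg
      rw [Fintype.sum_sum_type]
      simp only [Sum.elim_inl, Sum.elim_inr, hG, neg_mul, Finset.sum_neg_distrib]
      rw [← sub_eq_add_neg, ← Finset.sum_sub_distrib]
      have e : ∀ e, w e * G (N.src e) - w e * G (N.tgt e) =
          ∑ e', N.edgeCount (s e') e * (G (N.src e) - G (N.tgt e)) := fun e => by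
        rw [← mul_sub, Finset.sum_mul]
      refine (Finset.sum_congr rfl fun x _ => e x).trans ?_
      rw [Finset.sum_comm]
      refine Finset.sum_eq_zero fun e _ => ?_
      rw [N.sum_edgeCount_mul, hG', sub_self])
  refine ⟨h, hh, fun e => ?_⟩
  have := hh' (Sum.inl e)
  have := hw e
  simp at *
  linarith

/-- The half-edges at `v` form one cycle of the rotation, of length three by trivalency. -/
theorem rotation_pow_three {v : I} {d : E ⊕ E} (hd : Sum.elim N.src N.tgt d = .inner v) :
    N.rotation (N.rotation (N.rotation d)) = d ∧
      ∀ d', Sum.elim N.src N.tgt d' = .inner v →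
        d' = d ∨ d' = N.rotation d ∨ d' = N.rotation (N.rotation d) := by
  classical
  have hcard := N.trivalent v
  rw [Nat.card_eq_fintype_card, Fintype.card_subtype] at hcard
  have hpow : ∀ l : ℕ, Sum.elim N.src N.tgt ((N.rotation ^ l) d) = .inner v := by
    intro l
    induction l with
    | zero => exact hd
    | succ l ih =>
      rw [pow_succ', Equiv.Perm.mul_apply]
      exact N.rotation_inner v _ ih
  have hne : N.rotation d ≠ d := by
    intro h
    have : (Finset.univ.filter fun d' => Sum.elim N.src N.tgt d' = .inner v) ⊆ {d} := by
      intro d' hd'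
      obtain ⟨l, rfl⟩ := N.rotation_sameCycle v d d' hd (Finset.mem_filter.mp hd').2
      rw [Equiv.Perm.zpow_apply_eq_self_of_apply_eq_self h]
      exact Finset.mem_singleton_self d
    have := Finset.card_le_card this
    rw [hcard, Finset.card_singleton] at this
    omega
  have hs : (N.rotation.cycleOf d).support.card = 3 := by
    rw [← hcard]
    congr 1
    ext d'
    rw [Equiv.Perm.mem_support_cycleOf_iff' hne, Finset.mem_filter]
    constructor
    · intro h
      obtain ⟨l, -, rfl⟩ := h.exists_pow_eq'
      exact ⟨Finset.mem_univ _, hpow l⟩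
    · exact fun h => N.rotation_sameCycle v d d' hd h.2
  constructor
  · have := N.rotation.pow_mod_card_support_cycleOf_self_apply 3 d
    rw [hs] at this
    exact this.symm
  · intro d' hd'
    obtain ⟨l, hl, rfl⟩ := (N.rotation_sameCycle v d d' hd hd').exists_pow_eq_of_mem_support
      (Equiv.Perm.mem_support.mpr hne)
    rw [hs] at hl
    interval_cases l
    · exact Or.inl rfl
    · exact Or.inr (Or.inl rfl)
    · exact Or.inr (Or.inr rfl)

theorem isWhite_or_isBlack (v : I) :
    (∃ x₁ x₂ x₃, N.IsWhite v x₁ x₂ x₃ ∧ (∀ e, N.tgt e = .inner v → e = x₃) ∧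
      ∀ e, N.src e = .inner v → e = x₁ ∨ e = x₂) ∨
    ∃ y₁ y₂ y₃, N.IsBlack v y₁ y₂ y₃ ∧ (∀ e, N.tgt e = .inner v → e = y₁ ∨ e = y₂) ∧
      ∀ e, N.src e = .inner v → e = y₃ := by
  obtain ⟨a, ha⟩ := N.exists_incoming v
  obtain ⟨b, hb⟩ := N.exists_outgoing v
  obtain ⟨h3, hall⟩ := N.rotation_pow_three (d := Sum.inr a) ha
  have h1 := N.rotation_inner v (Sum.inr a) ha
  have h2 := N.rotation_inner v _ h1
  have hb' := hall (Sum.inl b) hb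
  -- After the incoming `a`, the pattern out-out is white, while out-in and in-out are black with
  -- the labels shifted cyclically. In-in contradicts the outgoing edge `b`.
  rcases hd : N.rotation (Sum.inr a) with x | x <;> rw [hd] at h1 h2 h3 hall hb' <;>
    rcases hd' : N.rotation _ with y | y <;> rw [hd'] at h2 h3 hall hb'
  · refine Or.inl ⟨x, y, a, ⟨h1, h2, ha, hd', h3, hd⟩, fun e he => ?_, fun e he => ?_⟩
    · simpa using hall (Sum.inr e) he
    · simpa using hall (Sum.inl e) he
  · refine Or.inr ⟨y, a, x, ⟨h2, ha, h1, h3, hd, hd'⟩, fun e he => ?_, fun e he => ?_⟩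
    · simpa [or_comm] using hall (Sum.inr e) he
    · simpa using hall (Sum.inl e) he
  · refine Or.inr ⟨a, x, y, ⟨ha, h1, h2, hd, hd', h3⟩, fun e he => ?_, fun e he => ?_⟩
    · simpa using hall (Sum.inr e) he
    · simpa using hall (Sum.inl e) he
  · simp at hb'

end PerfectPlanarNetwork

/-! ## The double Leibniz identities for arbitrary elements -/

namespace DoubleBracket

open PathAlgebra

variable {k Q : Type*} [CommRing k] [Quiver Q] [Fintype Q] (D : DoubleBracket k Q)

theorem idem_mul_bracket {a b c d : Q} (f : Quiver.Path a b) (g : Quiver.Path c d) :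
    (idem k c ⊗ₜ[k] idem k a) * D.bracket (ofPath k f) (ofPath k g) =
      D.bracket (ofPath k f) (ofPath k g) := by
  rw [← D.source_target f g, ← mul_assoc, ← mul_assoc, Algebra.TensorProduct.tmul_mul_tmul,
    idem_mul_idem, idem_mul_idem]

theorem bracket_mul_idem {a b c d : Q} (f : Quiver.Path a b) (g : Quiver.Path c d) :
    D.bracket (ofPath k f) (ofPath k g) * (idem k b ⊗ₜ[k] idem k d) =
      D.bracket (ofPath k f) (ofPath k g) := by
  rw [← D.source_target f g, mul_assoc, Algebra.TensorProduct.tmul_mul_tmul,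
    idem_mul_idem, idem_mul_idem]

/-- The local identities may be replaced by `1` because the bracket already has the prescribed ends;
for paths that do not compose, these ends make both terms vanish. -/
theorem bracket_mul_left (f g h : PathAlgebra k Q) :
    D.bracket (f * g) h = (1 ⊗ₜ[k] f) * D.bracket g h + D.bracket f h * (g ⊗ₜ[k] 1) := by
  induction h using PathAlgebra.induction with
  | zero => simp
  | add x y hx hy => rw [map_add, hx, hy, map_add, map_add, mul_add, add_mul]; abel
  | smul r x hx => simp only [map_smul, hx, smul_add, mul_smul_comm, smul_mul_assoc]
  | @path s t h =>
  induction f using PathAlgebra.induction with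
  | zero => simp
  | add x y hx hy =>
    rw [add_mul, map_add, LinearMap.add_apply, hx, hy, map_add, LinearMap.add_apply,
      TensorProduct.tmul_add, add_mul, add_mul]
    abel
  | smul r x hx =>
    simp only [map_smul, LinearMap.smul_apply, hx, smul_add, TensorProduct.tmul_smul,
      smul_mul_assoc]
  | @path a b f =>
  induction g using PathAlgebra.induction with
  | zero => simp
  | add x y hx hy =>
    rw [mul_add, map_add, LinearMap.add_apply, hx, hy, map_add, LinearMap.add_apply,
      TensorProduct.add_tmul, mul_add, mul_add]
    abel
  | smul r x hx =>
    simp only [mul_smul_comm, map_smul, LinearMap.smul_apply, hx, smul_add,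
      ← TensorProduct.smul_tmul']
  | @path c d g =>
  by_cases hbc : c = b
  · subst hbc
    rw [D.leibniz_left]
    congr 1
    · rw [← D.idem_mul_bracket g h, ← mul_assoc, ← mul_assoc,
        Algebra.TensorProduct.tmul_mul_tmul, Algebra.TensorProduct.tmul_mul_tmul, idem_mul_idem,
        one_mul]
    · rw [← D.bracket_mul_idem f h, mul_assoc, mul_assoc,
        Algebra.TensorProduct.tmul_mul_tmul, Algebra.TensorProduct.tmul_mul_tmul, idem_mul_idem,
        mul_one]
  · rw [ofPath_mul_ofPath_of_ne k f g hbc, ← D.idem_mul_bracket g h, ← D.bracket_mul_idem f h,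
      mul_assoc, ← mul_assoc, Algebra.TensorProduct.tmul_mul_tmul,
      Algebra.TensorProduct.tmul_mul_tmul, idem, idem, idem,
      ofPath_mul_ofPath_of_ne k f _ hbc, ofPath_mul_ofPath_of_ne k _ g hbc]
    simp

theorem bracket_mul_right (f g h : PathAlgebra k Q) :
    D.bracket f (g * h) = (g ⊗ₜ[k] 1) * D.bracket f h + D.bracket f g * (1 ⊗ₜ[k] h) := by
  rw [D.skew, bracket_mul_left, map_add, ArrowBracket.swap_mul, ArrowBracket.swap_mul,
    D.skew f h, D.skew f g, ArrowBracket.swap_tmul, ArrowBracket.swap_tmul, neg_add, mul_neg,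
    neg_mul]

variable {D}

theorem bracket_right_eq_zero {f : PathAlgebra k Q} (h : ∀ g, D.bracket f g = 0)
    (g : PathAlgebra k Q) : D.bracket g f = 0 := by
  rw [D.skew, h, map_zero, neg_zero]

/-- Elements with vanishing bracket behave as constants. This moves a cut past edges whose ends have
not yet been swept. -/
theorem bracket_mul_mul_of_eq_zero {x y : PathAlgebra k Q} (hx : ∀ g, D.bracket x g = 0)
    (hy : ∀ g, D.bracket y g = 0) (p q : PathAlgebra k Q) :
    D.bracket (p * x) (q * y) = D.bracket p q * (x ⊗ₜ[k] y) := by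
  rw [bracket_mul_left, hx, bracket_mul_right, bracket_right_eq_zero hy, mul_zero, zero_add,
    mul_zero, zero_add, mul_assoc, Algebra.TensorProduct.tmul_mul_tmul, one_mul, mul_one]

theorem bracket_mul_left_of_eq_zero {x : PathAlgebra k Q} (hx : ∀ g, D.bracket x g = 0)
    (p q : PathAlgebra k Q) : D.bracket (p * x) q = D.bracket p q * (x ⊗ₜ[k] 1) := by
  rw [bracket_mul_left, hx, mul_zero, zero_add]

/-- The bracket of two paths that separate at a white vertex. -/
theorem bracket_of_diverging {a a' z x y e : PathAlgebra k Q} {α β γ : k}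
    (ha : ∀ g, D.bracket a g = 0) (ha' : ∀ g, D.bracket a' g = 0) (hz : D.bracket z z = 0)
    (hxz : D.bracket x z = α • ((z * x) ⊗ₜ[k] e)) (hyz : D.bracket y z = β • ((z * y) ⊗ₜ[k] e))
    (hxy : D.bracket x y = γ • (x ⊗ₜ[k] y)) (hx : e * x = x) (hy : e * y = y) :
    D.bracket (a * z * x) (a' * z * y) =
      (γ + α - β) • ((a' * z * x) ⊗ₜ[k] (a * z * y)) := by
  have hzy : D.bracket z y = -(β • (e ⊗ₜ[k] (z * y))) := by
    rw [D.skew, hyz, map_smul, ArrowBracket.swap_tmul]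
  have h1 : D.bracket (a * z) (a' * z) = 0 := by
    rw [bracket_mul_left, ha, bracket_mul_right, hz, bracket_right_eq_zero ha']
    simp
  have h2 : D.bracket (a * z) y = -(β • (e ⊗ₜ[k] (a * z * y))) := by
    rw [bracket_mul_left, ha, hzy, zero_mul, add_zero, mul_neg, mul_smul_comm,
      Algebra.TensorProduct.tmul_mul_tmul, one_mul, mul_assoc]
  have h3 : D.bracket x (a' * z) = α • ((a' * z * x) ⊗ₜ[k] e) := by
    rw [bracket_mul_right, bracket_right_eq_zero ha', hxz, zero_mul, add_zero, mul_smul_comm,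
      Algebra.TensorProduct.tmul_mul_tmul, one_mul, mul_assoc]
  -- Three terms survive, all multiples of one tensor: `γ` from `x` against `y`, `α` from `x`
  -- against the second `z`, and `-β` from the first `z` against `y`.
  rw [bracket_mul_left, D.bracket_mul_right x, D.bracket_mul_right (a * z), h1, h2, h3, hxy]
  simp only [mul_add, mul_neg, neg_mul, zero_mul, add_zero, mul_smul_comm, smul_mul_assoc,
    Algebra.TensorProduct.tmul_mul_tmul, one_mul, mul_one, mul_assoc, hx, hy]
  module

/-- The bracket of two paths that meet at a black vertex. -/
theorem bracket_of_converging {a a' x y z e : PathAlgebra k Q} {α β γ : k}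
    (ha : ∀ g, D.bracket a g = 0) (ha' : ∀ g, D.bracket a' g = 0) (hz : D.bracket z z = 0)
    (hxz : D.bracket x z = α • (e ⊗ₜ[k] (x * z))) (hyz : D.bracket y z = β • (e ⊗ₜ[k] (y * z)))
    (hxy : D.bracket x y = γ • (y ⊗ₜ[k] x)) (he : e * z = z) :
    D.bracket (a * x * z) (a' * y * z) =
      (γ + α - β) • ((a' * y * z) ⊗ₜ[k] (a * x * z)) := by
  have hzy : D.bracket z y = -(β • ((y * z) ⊗ₜ[k] e)) := by
    rw [D.skew, hyz, map_smul, ArrowBracket.swap_tmul]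
  have h1 : D.bracket (a * x) (a' * y) = γ • ((a' * y) ⊗ₜ[k] (a * x)) := by
    rw [bracket_mul_left, ha, bracket_mul_right, hxy, bracket_right_eq_zero ha', zero_mul,
      zero_mul, add_zero, add_zero, mul_smul_comm, mul_smul_comm,
      Algebra.TensorProduct.tmul_mul_tmul, Algebra.TensorProduct.tmul_mul_tmul, one_mul, one_mul]
  have h2 : D.bracket (a * x) z = α • (e ⊗ₜ[k] (a * x * z)) := by
    rw [bracket_mul_left, ha, hxz, zero_mul, add_zero, mul_smul_comm,
      Algebra.TensorProduct.tmul_mul_tmul, one_mul, mul_assoc]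
  have h3 : D.bracket z (a' * y) = -(β • ((a' * y * z) ⊗ₜ[k] e)) := by
    rw [bracket_mul_right, bracket_right_eq_zero ha', hzy, zero_mul, add_zero, mul_neg,
      mul_smul_comm, Algebra.TensorProduct.tmul_mul_tmul, one_mul, mul_assoc]
  -- As for diverging paths, the surviving terms pair `x` with `y`, `x` with the second `z`, and the
  -- first `z` with `y`.
  rw [bracket_mul_left, D.bracket_mul_right z, D.bracket_mul_right (a * x), h1, h2, h3, hz]
  simp only [add_mul, mul_neg, neg_mul, mul_zero, zero_add, mul_smul_comm,
    smul_mul_assoc, Algebra.TensorProduct.tmul_mul_tmul, one_mul, mul_one, mul_assoc, he]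
  module

end DoubleBracket

/-! ## Brackets of partial networks and sums of paths -/

namespace PerfectPlanarNetwork

open PathAlgebra

variable {m n : ℕ} {I E : Type*} [Fintype I] [Fintype E] (N : PerfectPlanarNetwork m n I E)
  (k : Type*) [Field k] (c : LocalWeights k)

/-- The brackets of edges to which only the vertices in `S` contribute. -/
noncomputable def arrowBracketOn (S : Finset I) : ArrowBracket k N.Vertex where
  val e f := ∑ v ∈ S, (N.vertexTerm k c v e.1 f.1 -
    tensorSwap k N.Vertex (N.vertexTerm k c v f.1 e.1))
  source := by
    rintro a b a' b' ⟨e, ha, hb⟩ ⟨f, ha', hb'⟩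
    have h := fun v => congrArg (tensorSwap k N.Vertex) (N.vertexTerm_source k c v f e ha' ha)
    simp only [ArrowBracket.swap_mul, ArrowBracket.swap_tmul] at h
    simp only [Finset.mul_sum, mul_sub, N.vertexTerm_source k c _ e f ha ha', h]
  target := by
    rintro a b a' b' ⟨e, ha, hb⟩ ⟨f, ha', hb'⟩
    have h := fun v => congrArg (tensorSwap k N.Vertex) (N.vertexTerm_target k c v f e hb' hb)
    simp only [ArrowBracket.swap_mul, ArrowBracket.swap_tmul] at h
    simp only [Finset.sum_mul, sub_mul, N.vertexTerm_target k c _ e f hb hb', h]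
  skew e f := by
    simp only [map_sum, map_sub, swap_swap, ← Finset.sum_neg_distrib, neg_sub]

/-- The double bracket to which only the vertices in `S` contribute. -/
noncomputable def bracketOn (S : Finset I) : DoubleBracket k N.Vertex :=
  (N.arrowBracketOn k c S).toDoubleBracket

theorem bracketOn_ofPath (S : Finset I) {a b a' b' : N.Vertex} (p : Quiver.Path a b)
    (q : Quiver.Path a' b') :
    (N.bracketOn k c S).bracket (ofPath k p) (ofPath k q) =
      (N.arrowBracketOn k c S).extend p q := by
  simp only [bracketOn, ArrowBracket.toDoubleBracket, lift_ofPath]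

theorem bracketOn_edge (S : Finset I) (e f : E) :
    (N.bracketOn k c S).bracket (N.edge k e) (N.edge k f) =
      ∑ v ∈ S, (N.vertexTerm k c v e f - tensorSwap k N.Vertex (N.vertexTerm k c v f e)) :=
  ArrowBracket.toDoubleBracket_arrow _ _ _

theorem ofPath_toPath {a b : N.Vertex} (f : a ⟶ b) : ofPath k f.toPath = N.edge k f.1 := by
  obtain ⟨f, rfl, rfl⟩ := f
  rfl

theorem ofPath_cons_eq {a b b' : N.Vertex} (p : Quiver.Path a b) (f : b ⟶ b') :
    ofPath k (p.cons f) = ofPath k p * N.edge k f.1 := by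
  rw [ofPath_cons, ofPath_toPath]

theorem bracketOn_idem (S : Finset I) (a : N.Vertex) (y : PathAlgebra k N.Vertex) :
    (N.bracketOn k c S).bracket (idem k a) y = 0 := by
  induction y using PathAlgebra.induction with
  | zero => simp
  | add x y hx hy => rw [map_add, hx, hy, add_zero]
  | smul r x hx => rw [map_smul, hx, smul_zero]
  | path q =>
    rw [idem, bracketOn_ofPath]
    rfl

/-- By the Leibniz identity in the second argument, edges are enough as tests. -/
theorem bracketOn_eq_zero {S : Finset I} {x : PathAlgebra k N.Vertex}
    (hx : ∀ e, (N.bracketOn k c S).bracket x (N.edge k e) = 0) (y : PathAlgebra k N.Vertex) :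
    (N.bracketOn k c S).bracket x y = 0 := by
  induction y using PathAlgebra.induction with
  | zero => simp
  | add x y hx hy => rw [map_add, hx, hy, add_zero]
  | smul r x hx => rw [map_smul, hx, smul_zero]
  | path q =>
    induction q with
    | nil => exact DoubleBracket.bracket_right_eq_zero (N.bracketOn_idem k c S _) x
    | cons q f ih =>
      rw [ofPath_cons_eq, DoubleBracket.bracket_mul_right, ih, hx, mul_zero, zero_mul, add_zero]

theorem vertexTerm_eq_zero_left {v : I} {e : E} (h : N.src e ≠ .inner v)
    (h' : N.tgt e ≠ .inner v) (f : E) : N.vertexTerm k c v e f = 0 := by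
  simp [vertexTerm, IsWhite, IsBlack, h, h']

theorem vertexTerm_eq_zero_right {v : I} {e : E} (h : N.src e ≠ .inner v)
    (h' : N.tgt e ≠ .inner v) (f : E) : N.vertexTerm k c v f e = 0 := by
  simp [vertexTerm, IsWhite, IsBlack, h, h']

theorem bracketOn_edge_eq_zero {S : Finset I} {e : E}
    (h : ∀ v ∈ S, N.src e ≠ .inner v ∧ N.tgt e ≠ .inner v) (y : PathAlgebra k N.Vertex) :
    (N.bracketOn k c S).bracket (N.edge k e) y = 0 := by
  refine N.bracketOn_eq_zero k c (fun f => ?_) y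
  rw [bracketOn_edge]
  refine Finset.sum_eq_zero fun v hv => ?_
  rw [N.vertexTerm_eq_zero_left k c (h v hv).1 (h v hv).2,
    N.vertexTerm_eq_zero_right k c (h v hv).1 (h v hv).2, map_zero, sub_zero]

/-- Both sides obey the Leibniz identities and agree on pairs of edges. This isolates the effect of
sweeping over one more vertex. -/
theorem bracketOn_insert [DecidableEq I] {S : Finset I} {v : I} (hv : v ∉ S)
    (x y : PathAlgebra k N.Vertex) :
    (N.bracketOn k c (insert v S)).bracket x y =
      (N.bracketOn k c S).bracket x y + (N.bracketOn k c {v}).bracket x y := by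
  have hval : ∀ e f, (N.bracketOn k c (insert v S)).bracket (N.edge k e) (N.edge k f) =
      (N.bracketOn k c S).bracket (N.edge k e) (N.edge k f) +
        (N.bracketOn k c {v}).bracket (N.edge k e) (N.edge k f) := fun e f => by
    rw [bracketOn_edge, bracketOn_edge, bracketOn_edge, Finset.sum_insert hv,
      Finset.sum_singleton, add_comm]
  have hnil : ∀ T x a, (N.bracketOn k c T).bracket x (ofPath k (.nil : Quiver.Path a a)) = 0 :=
    fun T x a => DoubleBracket.bracket_right_eq_zero (N.bracketOn_idem k c T a) x
  have hnil' : ∀ T x a, (N.bracketOn k c T).bracket (ofPath k (.nil : Quiver.Path a a)) x = 0 :=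
    fun T x a => N.bracketOn_idem k c T a x
  have hedge : ∀ e, (N.bracketOn k c (insert v S)).bracket (N.edge k e) y =
      (N.bracketOn k c S).bracket (N.edge k e) y +
        (N.bracketOn k c {v}).bracket (N.edge k e) y := by
    intro e
    induction y using PathAlgebra.induction with
    | zero => simp
    | add x y hx hy => simp only [map_add, hx, hy]; abel
    | smul r x hx => simp only [map_smul, hx, smul_add]
    | path q =>
    induction q with
    | nil => simp only [hnil, add_zero]
    | cons q f ih =>
      simp only [ofPath_cons_eq, DoubleBracket.bracket_mul_right, ih, hval, mul_add, add_mul]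
      abel
  induction x using PathAlgebra.induction with
  | zero => simp
  | add x y hx hy => simp only [map_add, LinearMap.add_apply, hx, hy]; abel
  | smul r x hx => simp only [map_smul, LinearMap.smul_apply, hx, smul_add]
  | path p =>
  induction p with
  | nil => simp only [hnil', add_zero]
  | cons p e ih =>
    simp only [ofPath_cons_eq, DoubleBracket.bracket_mul_left, ih, hedge, mul_add, add_mul]
    abel

/-! ### Sums of paths, sorted by their last edge. -/

/-- The sum of all paths from the `i`-th source to the vertex `b`. -/
noncomputable def pathSum (i : Fin m) (b : N.Vertex) : PathAlgebra k N.Vertex :=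
  ∑ᶠ p : Quiver.Path (N.source i) b, ofPath k p

/-- The sum of all paths from the `i`-th source whose last edge is `e`. -/
noncomputable def edgeSum (i : Fin m) (e : E) : PathAlgebra k N.Vertex :=
  N.pathSum k i (N.src e) * N.edge k e

variable {N} in
/-- The last edge of a path. -/
def lastEdge {a : N.Vertex} : ∀ {b : N.Vertex}, Quiver.Path a b → Option E
  | _, Quiver.Path.nil => none
  | _, Quiver.Path.cons _ f => some f.1

variable {N} in
theorem pathSum_eq_sum (hN : N.Acyclic) {i : Fin m} {b : N.Vertex} (hb : b ≠ N.source i)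
    [DecidablePred fun e => N.tgt e = b] :
    N.pathSum k i b = ∑ e with N.tgt e = b, N.edgeSum k i e := by
  have hfin := fun b => N.finite_path_of_acyclic hN (N.source i) b
  have := fun b => Fintype.ofFinite (Quiver.Path (N.source i) b)
  have := fun e : {e : E // N.tgt e = b} => this (N.src e.1)
  -- Removing the last edge inverts this map; `hb` excludes the constant path, which has no last
  -- edge.
  let Φ : (Σ e : {e : E // N.tgt e = b}, Quiver.Path (N.source i) (N.src e.1)) →
      Quiver.Path (N.source i) b := fun x => x.2.cons ⟨x.1.1, rfl, x.1.2⟩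
  have hΦ : Function.Bijective Φ := by
    constructor
    · rintro ⟨⟨e, he⟩, p⟩ ⟨⟨e', he'⟩, p'⟩ h
      have h1 : e = e' := Option.some.inj (congrArg lastEdge h)
      subst h1
      have h2 : p = p' := (Quiver.Path.cons.inj h).2.1.eq
      rw [h2]
    · intro p
      cases p with
      | nil => exact absurd rfl hb
      | cons p f =>
        obtain ⟨f, rfl, hf⟩ := f
        exact ⟨⟨⟨f, hf⟩, p⟩, rfl⟩
  rw [pathSum, ← finsum_comp_equiv (Equiv.ofBijective Φ hΦ), finsum_eq_sum_of_fintype,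
    Fintype.sum_sigma, Finset.sum_subtype (p := fun e => N.tgt e = b) _ (by simp)]
  refine Finset.sum_congr rfl fun e _ => ?_
  refine Eq.trans ?_ (congrArg (· * N.edge k e.1) (finsum_eq_sum_of_fintype _)).symm
  refine Eq.trans ?_ (Finset.sum_mul _ _ _).symm
  exact Finset.sum_congr rfl fun p _ => N.ofPath_cons_eq k _ _

theorem pathSum_source_of_ne (hN : N.Acyclic) {i i' : Fin m} (h : i ≠ i') :
    N.pathSum k i (N.source i') = 0 := by
  classical
  rw [pathSum_eq_sum k hN (by rintro ⟨⟩; exact h rfl)]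
  refine Finset.sum_eq_zero fun e he => ?_
  exact absurd (Finset.mem_filter.mp he).2 (N.tgt_ne_source e i')

theorem pathSum_sink (hN : N.Acyclic) (i : Fin m) (j : Fin n) :
    N.pathSum k i (N.sink j) = N.edgeSum k i (N.sinkEdge j) := by
  classical
  rw [pathSum_eq_sum k hN (by rintro ⟨⟩), Finset.sum_eq_single (N.sinkEdge j)]
  · intro e he hne
    exact absurd ((N.tgt_eq_sink e j).mp (Finset.mem_filter.mp he).2) hne
  · intro h
    exact absurd ((Finset.mem_filter (p := fun e => N.tgt e = N.sink j)).mpr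
      ⟨Finset.mem_univ _, (N.tgt_eq_sink _ j).mpr rfl⟩) h

theorem boundaryMeasurement_apply (hN : N.Acyclic) (i : Fin m) (j : Fin n) :
    N.boundaryMeasurement k i j = N.edgeSum k i (N.sinkEdge j) :=
  N.pathSum_sink k hN i j

end PerfectPlanarNetwork

/-! ## The bracket of the sums of paths across a cut -/

/-- The sign of `x - y`, as a scalar. -/
def ordSign (k : Type*) [Field k] {α : Type*} [LinearOrder α] (x y : α) : k :=
  if x < y then -1 else if y < x then 1 else 0

section OrdSign

variable {k : Type*} [Field k] {α : Type*} [LinearOrder α] {x y : α}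

theorem ordSign_of_lt (h : x < y) : ordSign k x y = -1 := if_pos h

theorem ordSign_of_gt (h : y < x) : ordSign k x y = 1 := by
  rw [ordSign, if_neg h.not_gt, if_pos h]

theorem ordSign_self (x : α) : ordSign k x x = 0 := by simp [ordSign]

theorem ordSign_swap (x y : α) : ordSign k y x = -ordSign k x y := by
  rcases lt_trichotomy x y with h | rfl | h
  · rw [ordSign_of_lt h, ordSign_of_gt h, neg_neg]
  · rw [ordSign_self, neg_zero]
  · rw [ordSign_of_lt h, ordSign_of_gt h]

theorem StrictAnti.ordSign {β : Type*} [LinearOrder β] {f : α → β} (hf : StrictAnti f) (x y : α) :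
    ordSign k (f x) (f y) = ordSign k y x := by
  rcases lt_trichotomy x y with h | rfl | h
  · rw [ordSign_of_gt h, ordSign_of_gt (hf h)]
  · rw [ordSign_self, ordSign_self]
  · rw [ordSign_of_lt h, ordSign_of_lt (hf h)]

end OrdSign

namespace PerfectPlanarNetwork

open PathAlgebra

variable {m n : ℕ} {I E : Type*} [Fintype I] [Fintype E] {N : PerfectPlanarNetwork m n I E}
  {k : Type*} [Field k] {c : LocalWeights k}

/-! ### The bracket of a single vertex. -/

section LocalValues

variable {v : I}

theorem bracketOn_singleton_edge (e f : E) :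
    (N.bracketOn k c {v}).bracket (N.edge k e) (N.edge k f) =
      N.vertexTerm k c v e f - tensorSwap k N.Vertex (N.vertexTerm k c v f e) := by
  rw [bracketOn_edge, Finset.sum_singleton]

/-- Acyclicity rules out loops, so each edge meets `v` in one half-edge and carries one label; no
other local term can interfere. -/
theorem IsWhite.bracketOn_edge {x₁ x₂ x₃ : E} (h : N.IsWhite v x₁ x₂ x₃) (hN : N.Acyclic) :
    (N.bracketOn k c {v}).bracket (N.edge k x₁) (N.edge k x₂) =
        c.w₁₂ • (N.edge k x₁ ⊗ₜ[k] N.edge k x₂) ∧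
      (N.bracketOn k c {v}).bracket (N.edge k x₁) (N.edge k x₃) =
        c.w₁₃ • ((N.edge k x₃ * N.edge k x₁) ⊗ₜ[k] N.innerIdem k v) ∧
      (N.bracketOn k c {v}).bracket (N.edge k x₂) (N.edge k x₃) =
        c.w₂₃ • ((N.edge k x₃ * N.edge k x₂) ⊗ₜ[k] N.innerIdem k v) ∧
      (N.bracketOn k c {v}).bracket (N.edge k x₁) (N.edge k x₁) = 0 ∧
      (N.bracketOn k c {v}).bracket (N.edge k x₂) (N.edge k x₂) = 0 ∧
      (N.bracketOn k c {v}).bracket (N.edge k x₃) (N.edge k x₃) = 0 := by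
  obtain ⟨h1, h2, h3, r1, r2, r3⟩ := h
  have l1 : N.tgt x₁ ≠ .inner v := fun h => N.src_ne_tgt hN x₁ (h1.trans h.symm)
  have l2 : N.tgt x₂ ≠ .inner v := fun h => N.src_ne_tgt hN x₂ (h2.trans h.symm)
  have l3 : N.src x₃ ≠ .inner v := fun h => N.src_ne_tgt hN x₃ (h.trans h3.symm)
  have hne : x₁ ≠ x₂ := by
    rintro rfl
    simp [r1] at r2
  simp only [bracketOn_singleton_edge, vertexTerm, IsWhite, IsBlack]
  refine ⟨?_, ?_, ?_, ?_, ?_, ?_⟩ <;>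
    simp [h1, h2, h3, r1, r2, r3, l1, l2, l3, hne, hne.symm]

theorem IsBlack.bracketOn_edge {y₁ y₂ y₃ : E} (h : N.IsBlack v y₁ y₂ y₃) (hN : N.Acyclic) :
    (N.bracketOn k c {v}).bracket (N.edge k y₁) (N.edge k y₂) =
        c.b₁₂ • (N.edge k y₂ ⊗ₜ[k] N.edge k y₁) ∧
      (N.bracketOn k c {v}).bracket (N.edge k y₁) (N.edge k y₃) =
        c.b₁₃ • (N.innerIdem k v ⊗ₜ[k] (N.edge k y₁ * N.edge k y₃)) ∧
      (N.bracketOn k c {v}).bracket (N.edge k y₂) (N.edge k y₃) =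
        c.b₂₃ • (N.innerIdem k v ⊗ₜ[k] (N.edge k y₂ * N.edge k y₃)) ∧
      (N.bracketOn k c {v}).bracket (N.edge k y₁) (N.edge k y₁) = 0 ∧
      (N.bracketOn k c {v}).bracket (N.edge k y₂) (N.edge k y₂) = 0 ∧
      (N.bracketOn k c {v}).bracket (N.edge k y₃) (N.edge k y₃) = 0 := by
  obtain ⟨h1, h2, h3, r1, r2, r3⟩ := h
  have l1 : N.src y₁ ≠ .inner v := fun h => N.src_ne_tgt hN y₁ (h.trans h1.symm)
  have l2 : N.src y₂ ≠ .inner v := fun h => N.src_ne_tgt hN y₂ (h.trans h2.symm)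
  have l3 : N.tgt y₃ ≠ .inner v := fun h => N.src_ne_tgt hN y₃ (h3.trans h.symm)
  have hne : y₁ ≠ y₂ := by
    rintro rfl
    simp [r1] at r2
  simp only [bracketOn_singleton_edge, vertexTerm, IsWhite, IsBlack]
  refine ⟨?_, ?_, ?_, ?_, ?_, ?_⟩ <;>
    simp [h1, h2, h3, r1, r2, r3, l1, l2, l3, hne, hne.symm]

end LocalValues

/-! ### Cuts and the invariants of the sweep. -/

variable (N) in
/-- A set of internal vertices is closed under predecessors. -/
def IsDownClosed (S : Finset I) : Prop :=
  ∀ e u v, N.src e = .inner u → N.tgt e = .inner v → v ∈ S → u ∈ S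

variable (N) in
/-- An edge leads from the boundary or from `S` to the outside of `S`. -/
def IsCut (S : Finset I) (e : E) : Prop :=
  (∀ u, N.src e = .inner u → u ∈ S) ∧ ∀ u, N.tgt e = .inner u → u ∉ S

/-- By closure under predecessors, a path ending in `S` or at a source never meets `T`. Sinks are
excluded because the edge into a sink may start in `T`. -/
theorem bracketOn_pathSum_eq_zero (hN : N.Acyclic) {S T : Finset I} (hS : N.IsDownClosed S)
    (hT : ∀ v ∈ T, v ∉ S) (i : Fin m) {b : N.Vertex} (hb : ∀ u, b = .inner u → u ∈ S)
    (hb' : ∀ j, b ≠ .sink j)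
    (y : PathAlgebra k N.Vertex) :
    (N.bracketOn k c T).bracket (N.pathSum k i b) y = 0 := by
  have key : ∀ p : Quiver.Path (N.source i) b,
      (N.bracketOn k c T).bracket (ofPath k p) y = 0 := by
    intro p
    induction p with
    | nil => exact N.bracketOn_idem k c T _ y
    | @cons b b' p f ih =>
      have hf : ∀ u, b = .inner u → u ∈ S := by
        intro u hu
        rcases ht : N.tgt f.1 with i' | j | w
        · exact absurd ht (N.tgt_ne_source f.1 i')
        · exact absurd (f.2.2.symm.trans ht) (hb' j)
        · exact hS f.1 u w (f.2.1.trans hu) ht (hb w (f.2.2.symm.trans ht))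
      rw [ofPath_cons_eq, DoubleBracket.bracket_mul_left,
        ih hf fun j hj => N.src_ne_sink f.1 j (f.2.1.trans hj),
        N.bracketOn_edge_eq_zero k c fun v hv =>
          ⟨fun h => hT v hv (hf v (f.2.1.symm.trans h)),
            fun h => hT v hv (hb v (f.2.2.symm.trans h))⟩]
      simp
  have := N.finite_path_of_acyclic hN (N.source i) b
  have := Fintype.ofFinite (Quiver.Path (N.source i) b)
  rw [pathSum, finsum_eq_sum_of_fintype, map_sum, LinearMap.sum_apply]
  exact Finset.sum_eq_zero fun p _ => key p

theorem bracketOn_edgeSum_eq_zero (hN : N.Acyclic) {S : Finset I} (hS : N.IsDownClosed S)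
    {v : I} (hv : v ∉ S) (i : Fin m) {e : E} (he : N.IsCut S e) (hev : N.tgt e ≠ .inner v)
    (y : PathAlgebra k N.Vertex) :
    (N.bracketOn k c {v}).bracket (N.edgeSum k i e) y = 0 := by
  have hT : ∀ w ∈ ({v} : Finset I), w ∉ S := by simpa using hv
  rw [edgeSum, DoubleBracket.bracket_mul_left,
    bracketOn_pathSum_eq_zero hN hS hT i he.1 (N.src_ne_sink e),
    N.bracketOn_edge_eq_zero k c]
  · simp
  · intro w hw
    obtain rfl := Finset.mem_singleton.mp hw
    exact ⟨fun h => hv (he.1 _ h), hev⟩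

variable (N k c) in
/-- The bracket of the sums of paths that end with the edges `e` and `f`, for given heights. -/
def CutFormula (h : E ⊕ E → ℚ) (S : Finset I) (e f : E) : Prop :=
  ∀ i i' : Fin m, (N.bracketOn k c S).bracket (N.edgeSum k i e) (N.edgeSum k i' f) =
    (1 / 2 * (ordSign k i i' + ordSign k (h (Sum.inl f)) (h (Sum.inl e)))) •
      (N.edgeSum k i' e ⊗ₜ[k] N.edgeSum k i f)

/-- Skew-symmetry reverses both signs at once, so each pair of edges needs to be treated in one
order only. -/
theorem CutFormula.symm {h : E ⊕ E → ℚ} {S : Finset I} {e f : E}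
    (hef : N.CutFormula k c h S e f) : N.CutFormula k c h S f e := by
  intro i i'
  rw [DoubleBracket.skew, hef i' i, map_smul, ArrowBracket.swap_tmul, ordSign_swap i i',
    ordSign_swap (h (Sum.inl e)) (h (Sum.inl f)), ← neg_smul]
  congr 1
  ring

variable (N) in
/-- The heights of the edges across a cut form disjoint intervals. -/
def CutDisjoint (h : E ⊕ E → ℚ) (S : Finset I) : Prop :=
  ∀ e f, N.IsCut S e → N.IsCut S f → e ≠ f →
    h (Sum.inr e) ≤ h (Sum.inl f) ∨ h (Sum.inr f) ≤ h (Sum.inl e)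

section Step

variable {S : Finset I} {v : I}

theorem isCut_insert_cases [DecidableEq I] {e : E} (he : N.IsCut (insert v S) e) :
    N.src e = .inner v ∨ N.IsCut S e ∧ N.tgt e ≠ .inner v := by
  by_cases h : N.src e = .inner v
  · exact Or.inl h
  · refine Or.inr ⟨⟨fun u hu => ?_, fun u hu hS => he.2 u hu (Finset.mem_insert_of_mem hS)⟩,
      fun hu => he.2 v hu (Finset.mem_insert_self _ _)⟩
    rcases Finset.mem_insert.mp (he.1 u hu) with rfl | h'
    · exact absurd hu h
    · exact h'

theorem isCut_of_tgt [DecidableEq I] (hN : N.Acyclic) (hS' : N.IsDownClosed (insert v S))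
    (hv : v ∉ S) {e : E} (he : N.tgt e = .inner v) : N.IsCut S e := by
  refine ⟨fun u hu => ?_, fun u hu => ?_⟩
  · rcases Finset.mem_insert.mp (hS' e u v hu he (Finset.mem_insert_self _ _)) with rfl | h
    · exact absurd (hu.trans he.symm) (N.src_ne_tgt hN e)
    · exact h
  · rw [he] at hu
    obtain rfl := NetworkVertex.inner.inj hu
    exact hv

/-- An edge leaving `v` cannot enter `S`, since `v` would then be a predecessor in `S`. -/
theorem bracketOn_edge_eq_zero_of_src (hS : N.IsDownClosed S) (hv : v ∉ S) {e : E}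
    (he : N.src e = .inner v) (y : PathAlgebra k N.Vertex) :
    (N.bracketOn k c S).bracket (N.edge k e) y = 0 := by
  refine N.bracketOn_edge_eq_zero k c (fun u hu => ⟨fun h => ?_, fun h => hv (hS e v u he h hu)⟩) y
  rw [he] at h
  obtain rfl := NetworkVertex.inner.inj h
  exact hv hu

theorem IsWhite.edgeSum {x₁ x₂ x₃ x : E} (h : N.IsWhite v x₁ x₂ x₃)
    (htgt : ∀ e, N.tgt e = .inner v → e = x₃) (hN : N.Acyclic) (hx : N.src x = .inner v)
    (i : Fin m) : N.edgeSum k i x = N.edgeSum k i x₃ * N.edge k x := by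
  classical
  refine congrArg (· * N.edge k x) ((congrArg (N.pathSum k i) hx).trans ?_)
  refine (pathSum_eq_sum k hN (by rintro ⟨⟩)).trans ?_
  rw [Finset.sum_eq_single x₃]
  · intro e he hne
    exact absurd (htgt e (Finset.mem_filter.mp he).2) hne
  · intro hx₃
    exact absurd ((Finset.mem_filter (p := fun e => N.tgt e = N.inner v)).mpr
      ⟨Finset.mem_univ _, h.2.2.1⟩) hx₃

theorem IsBlack.edgeSum {y₁ y₂ y₃ : E} (h : N.IsBlack v y₁ y₂ y₃)
    (htgt : ∀ e, N.tgt e = .inner v → e = y₁ ∨ e = y₂) (hN : N.Acyclic) (i : Fin m) :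
    N.edgeSum k i y₃ = (N.edgeSum k i y₁ + N.edgeSum k i y₂) * N.edge k y₃ := by
  classical
  have hne : y₁ ≠ y₂ := by
    rintro rfl
    have := h.2.2.2.2.1
    simp [h.2.2.2.1] at this
  refine congrArg (· * N.edge k y₃) ((congrArg (N.pathSum k i) h.2.2.1).trans ?_)
  refine (pathSum_eq_sum k hN (by rintro ⟨⟩)).trans ?_
  rw [← Finset.sum_pair hne]
  refine Finset.sum_congr (Finset.ext fun e => ?_) fun _ _ => rfl
  rw [Finset.mem_insert, Finset.mem_singleton, Finset.mem_filter]
  refine ⟨fun he => htgt e he.2, fun he => ⟨Finset.mem_univ _, ?_⟩⟩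
  rcases he with rfl | rfl
  · exact h.1
  · exact h.2.1

end Step

end PerfectPlanarNetwork

/-! ### Sweeping over one vertex. -/

namespace PerfectPlanarNetwork

open PathAlgebra

variable {m n : ℕ} {I E : Type*} [Fintype I] [Fintype E] {N : PerfectPlanarNetwork m n I E}
  {k : Type*} [Field k] {c : LocalWeights k}

theorem edgeSum_converging {D : DoubleBracket k N.Vertex} {i i' : Fin m} {x y z : E}
    {e : PathAlgebra k N.Vertex} {α β γ : k}
    (hx : ∀ g, D.bracket (N.pathSum k i (N.src x)) g = 0)
    (hy : ∀ g, D.bracket (N.pathSum k i' (N.src y)) g = 0)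
    (bzz : D.bracket (N.edge k z) (N.edge k z) = 0)
    (bxz : D.bracket (N.edge k x) (N.edge k z) = α • (e ⊗ₜ[k] (N.edge k x * N.edge k z)))
    (byz : D.bracket (N.edge k y) (N.edge k z) = β • (e ⊗ₜ[k] (N.edge k y * N.edge k z)))
    (bxy : D.bracket (N.edge k x) (N.edge k y) = γ • (N.edge k y ⊗ₜ[k] N.edge k x))
    (he : e * N.edge k z = N.edge k z) :
    D.bracket (N.edgeSum k i x * N.edge k z) (N.edgeSum k i' y * N.edge k z) =
      (γ + α - β) • ((N.edgeSum k i' y * N.edge k z) ⊗ₜ[k] (N.edgeSum k i x * N.edge k z)) :=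
  DoubleBracket.bracket_of_converging hx hy bzz bxz byz bxy he

section Step

variable [DecidableEq I] {S : Finset I} {v : I} {h : E ⊕ E → ℚ}

/-- The edge `x` is a constant for `S`, and the paths ending with `f` are constants for `v`. Hence
the formula for `z` and `f` is just multiplied by `x`, and only the height comparison has to be
checked. -/
theorem cutFormula_of_branch (hN : N.Acyclic) (hS : N.IsDownClosed S) (hv : v ∉ S)
    {x z f : E} (hx : N.src x = .inner v)
    (hxz : ∀ i, N.edgeSum k i x = N.edgeSum k i z * N.edge k x)
    (hf : N.IsCut S f) (hfv : N.tgt f ≠ .inner v)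
    (hord : ordSign k (h (Sum.inl f)) (h (Sum.inl x)) =
      ordSign k (h (Sum.inl f)) (h (Sum.inl z)))
    (hcut : N.CutFormula k c h S z f) : N.CutFormula k c h (insert v S) x f := by
  intro i i'
  rw [bracketOn_insert N k c hv, DoubleBracket.bracket_right_eq_zero
    (bracketOn_edgeSum_eq_zero hN hS hv i' hf hfv), add_zero, hxz i,
    DoubleBracket.bracket_mul_left_of_eq_zero (bracketOn_edge_eq_zero_of_src hS hv hx),
    hcut i i', smul_mul_assoc, Algebra.TensorProduct.tmul_mul_tmul, ← hxz, mul_one, hord]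

theorem cutFormula_insert (hN : N.Acyclic) (hS : N.IsDownClosed S) (hv : v ∉ S) {e f : E}
    (hf : N.IsCut S f) (hfv : N.tgt f ≠ .inner v)
    (hcut : N.CutFormula k c h S e f) : N.CutFormula k c h (insert v S) e f := by
  intro i i'
  rw [bracketOn_insert N k c hv, DoubleBracket.bracket_right_eq_zero
    (bracketOn_edgeSum_eq_zero hN hS hv i' hf hfv), add_zero, hcut i i']

/-- The old vertices contribute the bracket of `z` with itself, where only the sign of the sources
remains. The height sign of `x` against `y` comes entirely from `v`. -/
theorem cutFormula_of_diverging (hN : N.Acyclic) (hS : N.IsDownClosed S) (hv : v ∉ S)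
    {x y z : E} (hx : N.src x = .inner v) (hy : N.src y = .inner v) (hz : N.IsCut S z)
    (hxz : ∀ i, N.edgeSum k i x = N.edgeSum k i z * N.edge k x)
    (hyz : ∀ i, N.edgeSum k i y = N.edgeSum k i z * N.edge k y) {α β γ : k}
    (bzz : (N.bracketOn k c {v}).bracket (N.edge k z) (N.edge k z) = 0)
    (bxz : (N.bracketOn k c {v}).bracket (N.edge k x) (N.edge k z) =
      α • ((N.edge k z * N.edge k x) ⊗ₜ[k] N.innerIdem k v))
    (byz : (N.bracketOn k c {v}).bracket (N.edge k y) (N.edge k z) =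
      β • ((N.edge k z * N.edge k y) ⊗ₜ[k] N.innerIdem k v))
    (bxy : (N.bracketOn k c {v}).bracket (N.edge k x) (N.edge k y) =
      γ • (N.edge k x ⊗ₜ[k] N.edge k y))
    (hord : γ + α - β = 1 / 2 * ordSign k (h (Sum.inl y)) (h (Sum.inl x)))
    (hcut : N.CutFormula k c h S z z) : N.CutFormula k c h (insert v S) x y := by
  intro i i'
  have hT : ∀ w ∈ ({v} : Finset I), w ∉ S := by simpa using hv
  have ha := fun i y => bracketOn_pathSum_eq_zero (k := k) (c := c) hN hS hT i hz.1
    (N.src_ne_sink z) y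
  have key : (N.bracketOn k c {v}).bracket (N.edgeSum k i z * N.edge k x)
      (N.edgeSum k i' z * N.edge k y) =
      (γ + α - β) • ((N.edgeSum k i' z * N.edge k x) ⊗ₜ[k] (N.edgeSum k i z * N.edge k y)) :=
    DoubleBracket.bracket_of_diverging (ha i) (ha i') bzz bxz byz bxy
    (N.idem_mul_edge k x hx) (N.idem_mul_edge k y hy)
  rw [bracketOn_insert N k c hv, hxz i, hyz i', DoubleBracket.bracket_mul_mul_of_eq_zero
    (bracketOn_edge_eq_zero_of_src hS hv hx) (bracketOn_edge_eq_zero_of_src hS hv hy), hcut i i',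
    ordSign_self, smul_mul_assoc, Algebra.TensorProduct.tmul_mul_tmul]
  rw [key, hord, hxz i', hyz i, ← add_smul]
  congr 1
  ring

/-- An interval that does not overlap `[p, r]` lies on the same side of its lower end and of any
interior point, so splitting or merging intervals does not change the sign. -/
theorem ordSign_eq_of_disjoint {a b p q r : ℚ} (hab : a < b) (hpq : p < q) (hqr : q < r)
    (hd : b ≤ p ∨ r ≤ a) : ordSign k a q = ordSign k a p := by
  rcases hd with hd | hd
  · rw [ordSign_of_lt (by linarith), ordSign_of_lt (by linarith)]
  · rw [ordSign_of_gt (by linarith), ordSign_of_gt (by linarith)]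

theorem forall_isCut_insert {x₁ x₂ : E} {P : E → E → Prop}
    (hsrc : ∀ e, N.src e = .inner v → e = x₁ ∨ e = x₂)
    (hsymm : ∀ e f, P e f → P f e)
    (h₁₁ : P x₁ x₁) (h₁₂ : P x₁ x₂) (h₂₂ : P x₂ x₂)
    (h₁ : ∀ f, N.IsCut S f → N.tgt f ≠ .inner v → P x₁ f)
    (h₂ : ∀ f, N.IsCut S f → N.tgt f ≠ .inner v → P x₂ f)
    (hold : ∀ e f, N.IsCut S e → N.IsCut S f → N.tgt e ≠ .inner v → N.tgt f ≠ .inner v → P e f)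
    (e f : E) (he : N.IsCut (insert v S) e) (hf : N.IsCut (insert v S) f) : P e f := by
  rcases isCut_insert_cases he with he | ⟨he, he'⟩ <;>
    rcases isCut_insert_cases hf with hf | ⟨hf, hf'⟩
  · rcases hsrc e he with rfl | rfl <;> rcases hsrc f hf with rfl | rfl
    exacts [h₁₁, h₁₂, hsymm _ _ h₁₂, h₂₂]
  · rcases hsrc e he with rfl | rfl
    exacts [h₁ f hf hf', h₂ f hf hf']
  · rcases hsrc f hf with rfl | rfl
    exacts [hsymm _ _ (h₁ e he he'), hsymm _ _ (h₂ e he he')]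
  · exact hold e f he hf he' hf'

theorem cut_insert_white (hN : N.Acyclic) (hW : c.w₁₂ + c.w₁₃ - c.w₂₃ = 1 / 2)
    (hh : ∀ d, h (N.rotation d) = h d.swap) (hh' : ∀ e, h (Sum.inl e) < h (Sum.inr e))
    (hS : N.IsDownClosed S) (hS' : N.IsDownClosed (insert v S)) (hv : v ∉ S) {x₁ x₂ x₃ : E}
    (hx : N.IsWhite v x₁ x₂ x₃) (htgt : ∀ e, N.tgt e = .inner v → e = x₃)
    (hsrc : ∀ e, N.src e = .inner v → e = x₁ ∨ e = x₂)
    (hd : N.CutDisjoint h S) (hcut : ∀ e f, N.IsCut S e → N.IsCut S f → N.CutFormula k c h S e f) :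
    N.CutDisjoint h (insert v S) ∧ ∀ e f, N.IsCut (insert v S) e → N.IsCut (insert v S) f →
      N.CutFormula k c h (insert v S) e f := by
  obtain ⟨b12, b13, b23, b11, b22, b33⟩ := hx.bracketOn_edge (k := k) (c := c) hN
  have e1 := fun i => hx.edgeSum (k := k) htgt hN hx.1 i
  have e2 := fun i => hx.edgeSum (k := k) htgt hN hx.2.1 i
  have h3 := isCut_of_tgt hN hS' hv hx.2.2.1
  obtain ⟨s1, s2, t3, r1, r2, r3⟩ := hx
  -- The three faces at `v` show that `x₁` and `x₂` subdivide the interval of `x₃`, with `x₁` as the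
  -- lower part.
  have q1 := hh (Sum.inl x₁)
  have q2 := hh (Sum.inl x₂)
  have q3 := hh (Sum.inr x₃)
  rw [r1, Sum.swap_inl] at q1
  rw [r2, Sum.swap_inl] at q2
  rw [r3, Sum.swap_inr] at q3
  have u1 := hh' x₁
  have u2 := hh' x₂
  have hne : ∀ f, N.tgt f ≠ .inner v → f ≠ x₃ := by
    rintro f hf rfl
    exact hf t3
  have hd3 : ∀ f, N.IsCut S f → N.tgt f ≠ .inner v →
      h (Sum.inr f) ≤ h (Sum.inl x₃) ∨ h (Sum.inr x₃) ≤ h (Sum.inl f) :=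
    fun f hf hf' => hd f x₃ hf h3 (hne f hf')
  constructor
  · refine forall_isCut_insert hsrc (fun e f hef hne => (hef hne.symm).symm) (absurd rfl)
      (fun _ => Or.inl q1.ge) (absurd rfl) (fun f hf hf' _ => ?_) (fun f hf hf' _ => ?_)
      fun e f he hf _ _ => hd e f he hf
    · rcases hd3 f hf hf' with h | h
      · exact Or.inr (by linarith)
      · exact Or.inl (by linarith)
    · rcases hd3 f hf hf' with h | h
      · exact Or.inr (by linarith)
      · exact Or.inl (by linarith)
  · refine forall_isCut_insert hsrc (fun e f => CutFormula.symm) ?_ ?_ ?_ ?_ ?_ ?_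
    -- Along the same branch `γ = 0` and `α = β`, so `v` contributes nothing.
    · exact cutFormula_of_diverging hN hS hv s1 s1 h3 e1 e1 b33 b13 b13
        (b11.trans (zero_smul k _).symm) (by rw [ordSign_self]; ring) (hcut _ _ h3 h3)
    · exact cutFormula_of_diverging hN hS hv s1 s2 h3 e1 e2 b33 b13 b23 b12
        (by rw [ordSign_of_gt (by linarith), hW, mul_one]) (hcut _ _ h3 h3)
    · exact cutFormula_of_diverging hN hS hv s2 s2 h3 e2 e2 b33 b23 b23
        (b22.trans (zero_smul k _).symm) (by rw [ordSign_self]; ring) (hcut _ _ h3 h3)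
    · exact fun f hf hf' => cutFormula_of_branch hN hS hv s1 e1 hf hf' (by rw [q3])
        (hcut _ _ h3 hf)
    · exact fun f hf hf' => cutFormula_of_branch hN hS hv s2 e2 hf hf'
        (ordSign_eq_of_disjoint (hh' f) (by linarith) (by linarith) (hd3 f hf hf'))
        (hcut _ _ h3 hf)
    · exact fun e f he hf _ hf' => cutFormula_insert hN hS hv hf hf' (hcut e f he hf)

theorem cut_insert_black (hN : N.Acyclic)
    (hB : c.b₁₂ + c.b₁₃ - c.b₂₃ = -(1 / 2))
    (hh : ∀ d, h (N.rotation d) = h d.swap) (hh' : ∀ e, h (Sum.inl e) < h (Sum.inr e))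
    (hS : N.IsDownClosed S) (hS' : N.IsDownClosed (insert v S)) (hv : v ∉ S) {y₁ y₂ y₃ : E}
    (hy : N.IsBlack v y₁ y₂ y₃) (htgt : ∀ e, N.tgt e = .inner v → e = y₁ ∨ e = y₂)
    (hsrc : ∀ e, N.src e = .inner v → e = y₃)
    (hd : N.CutDisjoint h S) (hcut : ∀ e f, N.IsCut S e → N.IsCut S f → N.CutFormula k c h S e f) :
    N.CutDisjoint h (insert v S) ∧ ∀ e f, N.IsCut (insert v S) e → N.IsCut (insert v S) f →
      N.CutFormula k c h (insert v S) e f := by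
  obtain ⟨b12, b13, b23, b11, b22, b33⟩ := hy.bracketOn_edge (k := k) (c := c) hN
  have e3 := fun i => hy.edgeSum (k := k) htgt hN i
  have c1 := isCut_of_tgt hN hS' hv hy.1
  have c2 := isCut_of_tgt hN hS' hv hy.2.1
  obtain ⟨t1, t2, s3, r1, r2, r3⟩ := hy
  -- The intervals of `y₂` below and `y₁` above are adjacent, and their union is the interval of
  -- `y₃`.
  have q1 := hh (Sum.inr y₁)
  have q2 := hh (Sum.inr y₂)
  have q3 := hh (Sum.inl y₃)
  rw [r1, Sum.swap_inr] at q1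
  rw [r2, Sum.swap_inr] at q2
  rw [r3, Sum.swap_inl] at q3
  have u1 := hh' y₁
  have u2 := hh' y₂
  have hd1 : ∀ f, N.IsCut S f → N.tgt f ≠ .inner v →
      h (Sum.inr f) ≤ h (Sum.inl y₁) ∨ h (Sum.inr y₁) ≤ h (Sum.inl f) :=
    fun f hf hf' => hd f y₁ hf c1 (by rintro rfl; exact hf' t1)
  have hd2 : ∀ f, N.IsCut S f → N.tgt f ≠ .inner v →
      h (Sum.inr f) ≤ h (Sum.inl y₂) ∨ h (Sum.inr y₂) ≤ h (Sum.inl f) :=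
    fun f hf hf' => hd f y₂ hf c2 (by rintro rfl; exact hf' t2)
  -- An interval of positive length cannot fit between two intervals that share an endpoint.
  have hd3 : ∀ f, N.IsCut S f → N.tgt f ≠ .inner v →
      h (Sum.inr f) ≤ h (Sum.inl y₂) ∨ h (Sum.inr y₁) ≤ h (Sum.inl f) := by
    intro f hf hf'
    have := hh' f
    rcases hd1 f hf hf' with h | h
    · rcases hd2 f hf hf' with h' | h'
      · exact Or.inl h'
      · linarith
    · exact Or.inr h
  -- The case analysis for two outgoing edges is reused with both of them equal to `y₃`.
  have hsrc' : ∀ e, N.src e = .inner v → e = y₃ ∨ e = y₃ := fun e he => Or.inl (hsrc e he)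
  constructor
  · have hnew : ∀ f, N.IsCut S f → N.tgt f ≠ .inner v → y₃ ≠ f →
        h (Sum.inr y₃) ≤ h (Sum.inl f) ∨ h (Sum.inr f) ≤ h (Sum.inl y₃) := by
      intro f hf hf' _
      rcases hd3 f hf hf' with h | h
      · exact Or.inr (by linarith)
      · exact Or.inl (by linarith)
    exact forall_isCut_insert hsrc' (fun e f hef hne => (hef hne.symm).symm) (absurd rfl)
      (absurd rfl) (absurd rfl) hnew hnew fun e f he hf _ _ => hd e f he hf
  -- An old edge `f` lies on the same side of `y₁` and `y₂`, so the two formulas have equal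
  -- coefficients and add up to the one for `y₃`.
  · have hold : ∀ f, N.IsCut S f → N.tgt f ≠ .inner v →
        N.CutFormula k c h (insert v S) y₃ f := by
      intro f hf hf' i i'
      rw [bracketOn_insert N k c hv, DoubleBracket.bracket_right_eq_zero
        (bracketOn_edgeSum_eq_zero hN hS hv i' hf hf'), add_zero, e3 i,
        DoubleBracket.bracket_mul_left_of_eq_zero (bracketOn_edge_eq_zero_of_src hS hv s3),
        map_add, LinearMap.add_apply, hcut _ _ c1 hf i i', hcut _ _ c2 hf i i',
        show ordSign k (h (Sum.inl f)) (h (Sum.inl y₁)) =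
            ordSign k (h (Sum.inl f)) (h (Sum.inl y₂)) from
          ordSign_eq_of_disjoint (hh' f) (by linarith) u1 (hd3 f hf hf'),
        ← smul_add, ← TensorProduct.add_tmul, smul_mul_assoc,
        Algebra.TensorProduct.tmul_mul_tmul, ← e3, mul_one, q2]
    have hself : N.CutFormula k c h (insert v S) y₃ y₃ := by
      intro i i'
      have hT : ∀ w ∈ ({v} : Finset I), w ∉ S := by simpa using hv
      have ha := fun i y => bracketOn_pathSum_eq_zero (k := k) (c := c) hN hS hT i c1.1
        (N.src_ne_sink y₁) y
      have ha' := fun i y => bracketOn_pathSum_eq_zero (k := k) (c := c) hN hS hT i c2.1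
        (N.src_ne_sink y₂) y
      have b21 : (N.bracketOn k c {v}).bracket (N.edge k y₂) (N.edge k y₁) =
          (-c.b₁₂) • (N.edge k y₁ ⊗ₜ[k] N.edge k y₂) := by
        rw [DoubleBracket.skew, b12, map_smul, ArrowBracket.swap_tmul, neg_smul]
      have he := N.idem_mul_edge k y₃ s3
      have z : ∀ x : PathAlgebra k N.Vertex ⊗[k] PathAlgebra k N.Vertex, (0 : k) • x = 0 :=
        zero_smul k
      -- At `v`, equal incoming edges contribute nothing and the mixed pairs contribute `-1/2` and
      -- `1/2`. These cancel the height signs in the mixed brackets over `S`, leaving only the sign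
      -- of the sources.
      have k11 := edgeSum_converging (ha i) (ha i') b33 b13 b13 (b11.trans (z _).symm) he
      have k12 := edgeSum_converging (ha i) (ha' i') b33 b13 b23 b12 he
      have k21 := edgeSum_converging (ha' i) (ha i') b33 b23 b13 b21 he
      have k22 := edgeSum_converging (ha' i) (ha' i') b33 b23 b23 (b22.trans (z _).symm) he
      rw [zero_add, sub_self, zero_smul] at k11 k22
      rw [hB] at k12
      rw [show -c.b₁₂ + c.b₂₃ - c.b₁₃ = 1 / 2 by linear_combination -hB] at k21
      have hzero := bracketOn_edge_eq_zero_of_src (k := k) (c := c) hS hv s3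
      rw [bracketOn_insert N k c hv, e3 i, e3 i', add_mul, add_mul]
      simp only [map_add, LinearMap.add_apply, k11, k12, k21, k22,
        DoubleBracket.bracket_mul_mul_of_eq_zero hzero hzero, hcut _ _ c1 c1 i i',
        hcut _ _ c1 c2 i i', hcut _ _ c2 c1 i i', hcut _ _ c2 c2 i i', ordSign_self,
        ordSign_of_lt (show h (Sum.inl y₂) < h (Sum.inl y₁) by linarith),
        ordSign_of_gt (show h (Sum.inl y₂) < h (Sum.inl y₁) by linarith),
        smul_mul_assoc, Algebra.TensorProduct.tmul_mul_tmul, TensorProduct.add_tmul,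
        TensorProduct.tmul_add]
      module
    exact forall_isCut_insert hsrc' (fun e f => CutFormula.symm) hself hself hself hold hold
      fun e f he hf _ hf' => cutFormula_insert hN hS hv hf hf' (hcut e f he hf)

end Step

/-! ### Sources and sinks: the two ends of the sweep. -/

/-- The face between two consecutive source edges is on the right of the first and on the left of
the second. -/
theorem height_sourceEdge_le {h : E ⊕ E → ℚ} (hh : ∀ d, h (N.rotation d) = h d.swap)
    (hh' : ∀ e, h (Sum.inl e) < h (Sum.inr e)) {i i' : Fin m} (hi : i < i') :
    h (Sum.inr (N.sourceEdge i')) ≤ h (Sum.inl (N.sourceEdge i)) := by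
  obtain ⟨i', hi'⟩ := i'
  induction i' with
  | zero => exact absurd hi (Nat.not_lt_zero _)
  | succ l ih =>
    have hr := hh (Sum.inl (N.sourceEdge ⟨l + 1, hi'⟩))
    rw [N.rotation_sourceEdge ⟨l, by omega⟩ ⟨l + 1, hi'⟩ rfl, Sum.swap_inl] at hr
    rw [← hr]
    rcases Nat.lt_succ_iff_lt_or_eq.mp (show (i : ℕ) < l + 1 from hi) with hl | hl
    · exact (hh' _).le.trans (ih _ hl)
    · obtain ⟨i, _⟩ := i
      obtain rfl : i = l := hl
      exact le_rfl

/-- As for the sources, consecutive sink edges share a face, on the right of the first and on the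
left of the second. -/
theorem strictAnti_height_sinkEdge {h : E ⊕ E → ℚ} (hh : ∀ d, h (N.rotation d) = h d.swap)
    (hh' : ∀ e, h (Sum.inl e) < h (Sum.inr e)) :
    StrictAnti fun j => h (Sum.inl (N.sinkEdge j)) := by
  rintro j ⟨j', hj'⟩ hj
  induction j' with
  | zero => exact absurd hj (Nat.not_lt_zero _)
  | succ l ih =>
    have hr := hh (Sum.inr (N.sinkEdge ⟨l, by omega⟩))
    rw [N.rotation_sinkEdge ⟨l, by omega⟩ ⟨l + 1, hj'⟩ rfl, Sum.swap_inr] at hr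
    have hlt := (hh' (N.sinkEdge ⟨l + 1, hj'⟩)).trans_eq hr
    rcases Nat.lt_succ_iff_lt_or_eq.mp (show (j : ℕ) < l + 1 from hj) with hl | hl
    · exact hlt.trans (ih _ hl)
    · obtain ⟨j, _⟩ := j
      obtain rfl : j = l := hl
      exact hlt

theorem cut_empty (hN : N.Acyclic) {h : E ⊕ E → ℚ} (hh : ∀ d, h (N.rotation d) = h d.swap)
    (hh' : ∀ e, h (Sum.inl e) < h (Sum.inr e)) :
    N.CutDisjoint h ∅ ∧ ∀ e f, N.IsCut ∅ e → N.IsCut ∅ f → N.CutFormula k c h ∅ e f := by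
  have hsrc : ∀ e, N.IsCut ∅ e → ∃ i, e = N.sourceEdge i := by
    intro e he
    rcases hs : N.src e with i | j | v
    · exact ⟨i, (N.src_eq_source e i).mp hs⟩
    · exact absurd hs (N.src_ne_sink e j)
    · exact absurd (he.1 v hs) (Finset.notMem_empty v)
  constructor
  · intro e f he hf hne
    obtain ⟨i, rfl⟩ := hsrc e he
    obtain ⟨i', rfl⟩ := hsrc f hf
    rcases lt_trichotomy i i' with hi | rfl | hi
    · exact Or.inr (height_sourceEdge_le hh hh' hi)
    · exact absurd rfl hne
    · exact Or.inl (height_sourceEdge_le hh hh' hi)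
  · intro e f he hf i i'
    obtain ⟨a, rfl⟩ := hsrc e he
    obtain ⟨b, rfl⟩ := hsrc f hf
    have hzero : ∀ i a, i ≠ a → N.edgeSum k i (N.sourceEdge a) = 0 := by
      intro i a hne
      have := (congrArg (N.pathSum k i) ((N.src_eq_source (N.sourceEdge a) a).mpr rfl)).trans
        (N.pathSum_source_of_ne k hN hne)
      rw [edgeSum, this, zero_mul]
    have hanti : StrictAnti fun a => h (Sum.inl (N.sourceEdge a)) :=
      fun a b hab => (hh' _).trans_le (height_sourceEdge_le hh hh' hab)
    have hleft : (N.bracketOn k c ∅).bracket (N.edgeSum k i (N.sourceEdge a))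
        (N.edgeSum k i' (N.sourceEdge b)) = 0 := by
      rw [edgeSum, DoubleBracket.bracket_mul_left, N.bracketOn_edge_eq_zero k c (by simp),
        bracketOn_pathSum_eq_zero hN (S := ∅) (fun _ _ _ _ _ h => absurd h (Finset.notMem_empty _))
          (by simp) i he.1 (N.src_ne_sink _), mul_zero, zero_mul, add_zero]
    rw [hleft]
    -- The right-hand tensor is nonzero only for `a = i'` and `b = i`; there the height sign is
    -- opposite to the sign of the sources.
    by_cases ha : i' = a
    · by_cases hb : i = b
      · rw [← ha, ← hb, hanti.ordSign, ordSign_swap i' i]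
        simp
      · rw [hzero i b hb, TensorProduct.tmul_zero, smul_zero]
    · rw [hzero i' a ha, TensorProduct.zero_tmul, smul_zero]

theorem cutFormula (hN : N.Acyclic)
    (hW : c.w₁₂ + c.w₁₃ - c.w₂₃ = 1 / 2) (hB : c.b₁₂ + c.b₁₃ - c.b₂₃ = -(1 / 2))
    {h : E ⊕ E → ℚ} (hh : ∀ d, h (N.rotation d) = h d.swap)
    (hh' : ∀ e, h (Sum.inl e) < h (Sum.inr e)) (S : Finset I) (hS : N.IsDownClosed S) :
    N.CutDisjoint h S ∧ ∀ e f, N.IsCut S e → N.IsCut S f → N.CutFormula k c h S e f := by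
  classical
  obtain ⟨r, hr⟩ := N.exists_rank hN
  induction S using Finset.strongInduction with
  | H S ih =>
  rcases S.eq_empty_or_nonempty with rfl | hne
  · exact cut_empty hN hh hh'
  -- A vertex of maximal rank precedes no other vertex of `S`, so removing it keeps `S` closed under
  -- predecessors.
  · obtain ⟨v, hv, hmax⟩ := S.exists_max_image (fun v => r (N.inner v)) hne
    have hdown : N.IsDownClosed (S.erase v) := by
      intro e u w hu hw hwS
      refine Finset.mem_erase.mpr ⟨?_, hS e u w hu hw (Finset.mem_of_mem_erase hwS)⟩
      rintro rfl
      have := hmax w (Finset.mem_of_mem_erase hwS)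
      have h1 : r (N.src e) = r (N.inner u) := congrArg r hu
      have h2 : r (N.tgt e) = r (N.inner w) := congrArg r hw
      have h3 := hr e
      omega
    obtain ⟨hd, hcut⟩ := ih _ (Finset.erase_ssubset hv) hdown
    have hv' := Finset.notMem_erase v S
    rw [← Finset.insert_erase hv] at hS ⊢
    rcases N.isWhite_or_isBlack v with ⟨x₁, x₂, x₃, hx, htgt, hsrc⟩ | ⟨y₁, y₂, y₃, hy, htgt, hsrc⟩
    · exact cut_insert_white hN hW hh hh' hdown hS hv' hx htgt hsrc hd hcut
    · exact cut_insert_black hN hB hh hh' hdown hS hv' hy htgt hsrc hd hcut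

theorem bracket_boundaryMeasurement (hN : N.Acyclic)
    (hW : c.w₁₂ + c.w₁₃ - c.w₂₃ = 1 / 2) (hB : c.b₁₂ + c.b₁₃ - c.b₂₃ = -(1 / 2))
    (i i' : Fin m) (j j' : Fin n) :
    (N.doubleBracket k c).bracket (N.boundaryMeasurement k i j) (N.boundaryMeasurement k i' j') =
      (1 / 2 * (ordSign k i i' + ordSign k j j')) •
        (N.boundaryMeasurement k i' j ⊗ₜ[k] N.boundaryMeasurement k i j') := by
  obtain ⟨h, hh, hh'⟩ := N.exists_height hN
  have hsink : ∀ j, N.IsCut Finset.univ (N.sinkEdge j) := by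
    refine fun j => ⟨fun u _ => Finset.mem_univ u, fun u hu => ?_⟩
    have := ((N.tgt_eq_sink (N.sinkEdge j) j).mpr rfl).symm.trans hu
    simp at this
  -- With all internal vertices swept, the sink edges lie across the cut.
  have key := (cutFormula hN hW hB hh hh' Finset.univ fun _ u _ _ _ _ => Finset.mem_univ u).2
    _ _ (hsink j) (hsink j') i i'
  rw [(strictAnti_height_sinkEdge hh hh').ordSign] at key
  simp only [N.boundaryMeasurement_apply k hN]
  -- The bracket to which all internal vertices contribute is the full bracket by definition.
  exact key

end PerfectPlanarNetwork

/-! ## The matrix identity -/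

section Matrices

variable {k Q : Type*} [Field k] [Quiver Q] [Fintype Q]

/-- The matrix is the flip of the two indices weighted by half a sign, so one summand survives in
each entry of a product with it. -/
theorem rMatrix_apply {n : ℕ} (i i' a b : Fin n) :
    rMatrix k Q n (i, i') (a, b) =
      if a = i' ∧ b = i then algebraMap k _ (1 / 2 * ordSign k i i') else 0 := by
  rw [rMatrix, Matrix.map_apply, Matrix.smul_apply, Matrix.sum_apply]
  have h : ∀ x y : Fin n, (if x < y then
      Matrix.single y x (1 : k) ⊗ₖ Matrix.single x y (1 : k) -
        Matrix.single x y (1 : k) ⊗ₖ Matrix.single y x (1 : k) else 0) (i, i') (a, b) =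
      (if x = i' then if y = i then if i' < i ∧ a = i' ∧ b = i then 1 else 0 else 0 else 0) -
        if x = i then if y = i' then if i < i' ∧ a = i' ∧ b = i then 1 else 0 else 0 else 0 := by
    intro x y
    rw [apply_ite (fun M : Matrix (Fin n × Fin n) (Fin n × Fin n) k => M (i, i') (a, b))]
    simp only [Matrix.sub_apply, Matrix.kroneckerMap_apply, Matrix.single_apply, Matrix.zero_apply]
    grind
  simp only [Matrix.sum_apply, h, Finset.sum_sub_distrib, Finset.sum_ite_eq', Finset.mem_univ,
    if_true, Finset.sum_ite_irrel, Finset.sum_const_zero]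
  by_cases hab : a = i' ∧ b = i
  · rw [if_pos hab]
    congr 1
    rcases lt_trichotomy i i' with hi | rfl | hi
    · simp [hab, hi, hi.not_gt, ordSign_of_lt hi]
    · simp [ordSign_self]
    · simp [hab, hi, hi.not_gt, ordSign_of_gt hi]
  · simp [hab]

theorem rMatrix_mul_kronecker {m n : ℕ} (B : Matrix (Fin m) (Fin n) (PathAlgebra k Q))
    (i i' : Fin m) (j j' : Fin n) :
    (rMatrix k Q m * Matrix.kroneckerMap (· * ·) (matrixL B) (matrixR B)) (i, i') (j, j') =
      (1 / 2 * ordSign k i i') • (B i' j ⊗ₜ[k] B i j') := by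
  rw [Matrix.mul_apply, Finset.sum_eq_single (i', i)]
  · rw [rMatrix_apply, if_pos ⟨rfl, rfl⟩, ← Algebra.smul_def, Matrix.kroneckerMap_apply, matrixL,
      matrixR, Matrix.map_apply, Matrix.map_apply, Algebra.TensorProduct.tmul_mul_tmul, one_mul,
      mul_one]
  · rintro ⟨a, b⟩ - hab
    rw [rMatrix_apply, if_neg fun h => hab (Prod.ext h.1 h.2), zero_mul]
  · simp

/-- The surviving row `(j', j)` is reversed, whence the minus sign. Swapping the tensor factors
afterwards produces the same tensor as multiplication by `r_m` on the left. -/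
theorem kronecker_mul_rMatrix {m n : ℕ} (B : Matrix (Fin m) (Fin n) (PathAlgebra k Q))
    (i i' : Fin m) (j j' : Fin n) :
    (Matrix.kroneckerMap (· * ·) (matrixL B) (matrixR B) * rMatrix k Q n) (i, i') (j, j') =
      -((1 / 2 * ordSign k j j') • (B i j' ⊗ₜ[k] B i' j)) := by
  rw [Matrix.mul_apply, Finset.sum_eq_single (j', j)]
  · rw [rMatrix_apply, if_pos ⟨rfl, rfl⟩, ← Algebra.commutes, ← Algebra.smul_def,
      Matrix.kroneckerMap_apply, matrixL, matrixR, Matrix.map_apply, Matrix.map_apply,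
      Algebra.TensorProduct.tmul_mul_tmul, one_mul, mul_one, ordSign_swap j j', mul_neg, neg_smul]
  · rintro ⟨a, b⟩ - hab
    rw [rMatrix_apply, if_neg fun h => hab (Prod.ext h.2.symm h.1.symm), mul_zero]
  · simp

end Matrices

theorem PerfectPlanarNetwork.matrixBracket_boundaryMeasurement {k : Type*} [Field k]
    {I E : Type*} [Fintype I] [Fintype E] (c : LocalWeights k)
    (hW : c.w₁₂ + c.w₁₃ - c.w₂₃ = 1 / 2) (hB : c.b₁₂ + c.b₁₃ - c.b₂₃ = -(1 / 2))
    {m n : ℕ} (N : PerfectPlanarNetwork m n I E) (hN : N.Acyclic) :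
    (N.doubleBracket k c).matrixBracket (N.boundaryMeasurement k) (N.boundaryMeasurement k) =
      rMatrix k N.Vertex m *
          (matrixL (N.boundaryMeasurement k) ⊗ₖ matrixR (N.boundaryMeasurement k)) -
        matrixSwap
          ((matrixL (N.boundaryMeasurement k) ⊗ₖ matrixR (N.boundaryMeasurement k)) *
            rMatrix k N.Vertex n) := by
  ext ⟨i, i'⟩ ⟨j, j'⟩
  rw [Matrix.sub_apply, matrixSwap, Matrix.map_apply]
  refine (N.bracket_boundaryMeasurement hN hW hB i i' j j').trans ?_
  refine Eq.trans ?_ (congrArg₂ (· - ·) (rMatrix_mul_kronecker _ i i' j j').symm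
    (congrArg (tensorSwap k N.Vertex) (kronecker_mul_rMatrix _ i i' j j').symm))
  rw [map_neg, map_smul, ArrowBracket.swap_tmul, sub_neg_eq_add, mul_add, add_smul]

theorem mainTheorem1 {k : Type*} [Field k] (h2 : (2 : k) ≠ 0)
    {I E : Type*} [Fintype I] [Fintype E] (c : LocalWeights k)
    (hW : c.w₁₂ + c.w₁₃ - c.w₂₃ = 1 / 2) (hB : c.b₁₂ + c.b₁₃ - c.b₂₃ = -(1 / 2)) :
    (∀ (m n : ℕ) (N : PerfectPlanarNetwork m n I E), N.Acyclic →
      (N.doubleBracket k c).matrixBracket (N.boundaryMeasurement k) (N.boundaryMeasurement k) =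
        rMatrix k N.Vertex m *
            (matrixL (N.boundaryMeasurement k) ⊗ₖ matrixR (N.boundaryMeasurement k)) -
          matrixSwap
            ((matrixL (N.boundaryMeasurement k) ⊗ₖ matrixR (N.boundaryMeasurement k)) *
              rMatrix k N.Vertex n)) ∧
    (∀ (n : ℕ) (N : PerfectPlanarNetwork n n I E), N.Acyclic →
      (N.doubleBracket k c).matrixBracket (N.boundaryMeasurement k) (N.boundaryMeasurement k) =
        twistedCommutator (rMatrix k N.Vertex n)
          (matrixL (N.boundaryMeasurement k) ⊗ₖ matrixR (N.boundaryMeasurement k))) :=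
  ⟨fun _ _ N hN => N.matrixBracket_boundaryMeasurement c hW hB hN,
    -- For `m = n` the right-hand side unfolds to the twisted commutator.
    fun _ N hN => N.matrixBracket_boundaryMeasurement c hW hB hN⟩
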